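/- Let $M$ be a smooth finite-dimensional manifold (Hausdorff, $\sigma$-compact, without boundary) and let $((E,\pi,M),[\,,]_{E,h},(\rho,\eta))$ be a generalized Lie algebroid over $M$: $\pi:E\to M$ is a smooth real vector bundle of finite rank, $h$ and $\eta$ are diffeomorphisms of $M$, $\rho:E\to TM$ is a vector bundle morphism covering $\eta$, and $[\,,]_{E,h}$ is a Lie bracket on $\Gamma(E)$ with $[u,fv]=f[u,v]+\Gamma(Th\circ\rho,h\circ\eta)(u)(f)\,v$. (These axioms force $\rho=0$ on $E_{h(x)}$ unless $\eta(h(x))=x$; so $\rho$ restricted to $E_{h(x)}$ may be regarded as a map $E_{h(x)}\to T_xM$.) Let $g:E\to E$ be a vector bundle morphism covering $h$ which is an isomorphism on each fibre. The generalized tangent bundle $(\rho,\eta)TE$ has as its fibre at $u\in E$ the pairs $(X,Y)\in E_{h(\pi(u))}\times T_uE$ with $T\pi(Y)=\rho(X)$. It is a Lie algebroid over $E$ with anchor $\tilde\rho(X,Y)=Y$; the $TE$-component of its bracket is the bracket of vector fields, and its other component is determined by $[e\circ h\circ\pi,e'\circ h\circ\pi]=[e,e']_{E,h}\circ h\circ\pi$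 for $e,e'\in\Gamma(E)$ and the Leibniz rule. The Liouville section $\mathbb C$ is $u\mapsto(0,u^{v})$, where $w^{v}\in T_uE$ denotes the vertical lift of $w\in E_{\pi(u)}$, and $\mathcal J_{(g,h)}(X,Y)=(0,(g^{-1}X)^{v})$. Let $E^\circ$ be either $E$ or $E$ without its zero section. A mechanical $(\rho,\eta)$-system $(E,F_e,(\rho,\eta)\Gamma)$ consists of a section $F_e$ (the external force) of the vertical subbundle $V(\rho,\eta)TE=\{(0,Y)\}$ and of a $(\rho,\eta)$-connection, that is, a vector bundle morphism $(\rho,\eta)\Gamma:(\rho,\eta)TE\to V(\rho,\eta)TE$ which is the identity on $V(\rho,\eta)TE$; both are smooth on $E^\circ$. A $(\rho,\eta)$-spray of this system is a section $S$ of $(\rho,\eta)TE$, smooth on $E^\circ$ and of class $C^1$ on $E$, such that $\mathcal J_{(g,h)}(S)=\mathbb C$, $[\mathbb C,S]=S$, and the horizontal projector $\mathrm{Id}-(\rho,\eta)\Gamma$ equals $Z\mapsto\frac12\big(Z+[\mathcal J_{(g,h)}Z,S]-\mathcal J_{(g,h)}[Z,S]\big)$ over $E^\circ$. A geodesic with respect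 to $S$ is a differentiable curve $c:I\to M$ on an open interval $I$ together with a $(g,h)$-lift $\dot c:I\to E$ (a differentiable curve with $\pi\circ\dot c=\eta\circ h\circ c$ and $\rho(g(\dot c(t)))=\frac{d}{dt}(\eta\circ h\circ c)(t)$) which is an integral curve of $S$: $\frac{d\dot c}{dt}(t)=\tilde\rho(S(\dot c(t)))$. A strictly increasing parameter transformation is a differentiable bijection $\varphi:J\to I$ of open intervals with $\varphi'>0$; it carries $(c,\dot c)$ to $(c\circ\varphi,\ \varphi'\cdot(\dot c\circ\varphi))$. **Theorem.** Let $S$ and $\bar S$ be $(\rho,\eta)$-sprays of two mechanical $(\rho,\eta)$-systems $(E,F_e,(\rho,\eta)\Gamma)$ and $(E,\bar F_e,(\rho,\eta)\bar\Gamma)$ on the same generalized Lie algebroid, with the same $(g,h)$ and the same $E^\circ$. Then the following are equivalent: 1. $S$ and $\bar S$ are projectively related: there is a function $f:E\to\mathbb R$, of class $C^1$ on $E^\circ$ and 1-homogeneous there (that is, $\tilde\rho(\mathbb C)f=f$ on $E^\circ$), with $\bar S=S+f\,\mathbb C$. 2. The geodesics of $S$ and $\bar S$ differ only in a strictly increasing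 parameter transformation: every geodesic $(c,\dot c)$ with respect to $S$ is carried by some strictly increasing parameter transformation to a geodesic with respect to $\bar S$, and conversely with $S$ and $\bar S$ exchanged. -/

import Mathlib

open Bundle Set VectorField
open scoped Manifold ContDiff Bundle

noncomputable section

namespace GenLieAlg

/-- The derivative `v(f)` of a real-valued function `f` along the tangent vector `v` at `x`. -/
def dirDeriv {V H X : Type*} [NormedAddCommGroup V] [NormedSpace ℝ V] [TopologicalSpace H]
    (I : ModelWithCorners ℝ V H) [TopologicalSpace X] [ChartedSpace H X]
    (f : X → ℝ) (x : X) (v : TangentSpace I x) : ℝ :=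
  mfderiv I 𝓘(ℝ, ℝ) f x v

variable {B : Type*} [NormedAddCommGroup B] [NormedSpace ℝ B]
  {F : Type*} [NormedAddCommGroup F] [NormedSpace ℝ F]
  {M : Type*} [TopologicalSpace M] [ChartedSpace B M] [IsManifold 𝓘(ℝ, B) ∞ M]
  {E : M → Type*} [∀ x, AddCommGroup (E x)] [∀ x, Module ℝ (E x)] [∀ x, TopologicalSpace (E x)]
  [TopologicalSpace (TotalSpace F E)] [FiberBundle F E] [VectorBundle ℝ F E]
  [ContMDiffVectorBundle ∞ F E 𝓘(ℝ, B)]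

variable (B F M E) in
/-- A generalized Lie algebroid `((E, π, M), [ , ]_{E,h}, (ρ, η))` over the manifold `M`:
diffeomorphisms `h`, `η` of `M`, a vector bundle morphism `(ρ, η) : E → TM` (given fibrewise,
`ρ_y : E_y → T_{η y} M`) and a Lie bracket on the smooth sections of `E` such that
`[u, f v] = f [u, v] + (Γ(Th ∘ ρ, h ∘ η) u)(f) v`.  The vector field `Γ(Th ∘ ρ, h ∘ η) u` takes at
the point `h (η z)` the value `T h (ρ_z (u z))`; every point of `M` is of the form `h (η z)`. -/
structure GenLieAlgebroid where
  h : M ≃ₘ^∞⟮𝓘(ℝ, B), 𝓘(ℝ, B)⟯ M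
  η : M ≃ₘ^∞⟮𝓘(ℝ, B), 𝓘(ℝ, B)⟯ M
  ρ : ∀ y : M, E y →ₗ[ℝ] TangentSpace 𝓘(ℝ, B) (η y)
  ρ_smooth : ContMDiff (𝓘(ℝ, B).prod 𝓘(ℝ, F)) 𝓘(ℝ, B).tangent ∞
    (fun u : TotalSpace F E => (⟨η u.proj, ρ u.proj u.2⟩ : TangentBundle 𝓘(ℝ, B) M))
  bracket : Cₛ^∞⟮𝓘(ℝ, B); F, E⟯ →ₗ[ℝ] Cₛ^∞⟮𝓘(ℝ, B); F, E⟯ →ₗ[ℝ] Cₛ^∞⟮𝓘(ℝ, B); F, E⟯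
  bracket_self : ∀ u, bracket u u = 0
  jacobi : ∀ u v w,
    bracket u (bracket v w) + bracket v (bracket w u) + bracket w (bracket u v) = 0
  leibniz : ∀ (u v w : Cₛ^∞⟮𝓘(ℝ, B); F, E⟯) (f : M → ℝ), ContMDiff 𝓘(ℝ, B) 𝓘(ℝ, ℝ) ∞ f →
    (∀ x, w x = f x • v x) → ∀ z : M,
      bracket u w (h (η z)) = f (h (η z)) • bracket u v (h (η z)) +
        dirDeriv 𝓘(ℝ, B) f (h (η z))
          (mfderiv 𝓘(ℝ, B) 𝓘(ℝ, B) h (η z) (ρ z (u z))) • v (h (η z))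

/-- A locally invertible vector bundle morphism `(g, h) : E → E` over the diffeomorphism `h` of
the generalized Lie algebroid: fibrewise isomorphisms `g_x : E_x → E_{h x}`, smooth in `x`. -/
structure LocInvMorphism (A : GenLieAlgebroid B F M E) where
  g : ∀ x : M, E x ≃ₗ[ℝ] E (A.h x)
  smooth : ContMDiff (𝓘(ℝ, B).prod 𝓘(ℝ, F)) (𝓘(ℝ, B).prod 𝓘(ℝ, F)) ∞
    (fun u : TotalSpace F E => TotalSpace.mk' F (A.h u.proj) (g u.proj u.2))

variable (A : GenLieAlgebroid B F M E)

open Classical in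
/-- The pull-back anchor `E_{h x} → T_x M`, `X^a S_a ↦ X^a (ρ_a^i ∘ h) ∂/∂x^i`.  The map `ρ` sends
`E_{h x}` to `T_{η (h x)} M`.  The Leibniz rule and the Jacobi identity force `ρ = 0` on `E_{h x}`
unless `η (h x) = x`, so that in either case this is the anchor, regarded at the point `x`. -/
def anchorAt (x : M) : E (A.h x) →ₗ[ℝ] TangentSpace 𝓘(ℝ, B) x :=
  if hx : A.η (A.h x) = x then
    Eq.rec (motive := fun y _ => E (A.h x) →ₗ[ℝ] TangentSpace 𝓘(ℝ, B) y) (A.ρ (A.h x)) hx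
  else 0

/-- The fibre at `u` of the generalized tangent bundle `(ρ, η)TE ⊆ (h ∘ π)^* E ⊕ TE`: the pairs
`(X, Y)` with `X ∈ E_{h (π u)}`, `Y ∈ T_u E` and `Tπ Y = ρ X`, that is, the pairs
`X^a S_a ⊕ (X^a (ρ_a^i ∘ h ∘ π) ∂_i + X̃^a ∂̇_a)`. -/
def Prolong (u : TotalSpace F E) :
    Submodule ℝ (E (A.h u.proj) × TangentSpace (𝓘(ℝ, B).prod 𝓘(ℝ, F)) u) :=
  LinearMap.eqLocus
    ((mfderiv (𝓘(ℝ, B).prod 𝓘(ℝ, F)) 𝓘(ℝ, B) (π F E) u).toLinearMap ∘ₗ LinearMap.snd ℝ _ _)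
    (anchorAt A u.proj ∘ₗ LinearMap.fst ℝ _ _)

/-- Not necessarily regular sections of `(ρ, η)TE`. -/
abbrev PSection : Type _ := ∀ u : TotalSpace F E, Prolong A u

variable {A}

/-- The component in `(h ∘ π)^* E` of a section of `(ρ, η)TE`; this is `(ρ, η)π!`. -/
def PSection.fst (Z : PSection A) (u : TotalSpace F E) : E (A.h u.proj) := (Z u).1.1

/-- The component in `TE` of a section of `(ρ, η)TE`, a vector field on the total space; this is
the anchor `Γ(ρ̃, Id_E) Z`. -/
def PSection.snd (Z : PSection A) (u : TotalSpace F E) :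
    TangentSpace (𝓘(ℝ, B).prod 𝓘(ℝ, F)) u := (Z u).1.2

/-- The section `Z` of `(ρ, η)TE` is of class `C^n` on `D ⊆ E`. -/
def PSection.RegularOn (Z : PSection A) (n : ℕ∞) (D : Set (TotalSpace F E)) : Prop :=
  ContMDiffOn (𝓘(ℝ, B).prod 𝓘(ℝ, F)) (𝓘(ℝ, B).prod 𝓘(ℝ, F)) n
    (fun u : TotalSpace F E => TotalSpace.mk' F (A.h u.proj) (Z.fst u)) D ∧
  ContMDiffOn (𝓘(ℝ, B).prod 𝓘(ℝ, F)) (𝓘(ℝ, B).prod 𝓘(ℝ, F)).tangent n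
    (fun u : TotalSpace F E =>
      (⟨u, Z.snd u⟩ : TangentBundle (𝓘(ℝ, B).prod 𝓘(ℝ, F)) (TotalSpace F E))) D

/-- The vertical lift of `w ∈ E_{π u}` to `T_u E`: the velocity at `t = 0` of `t ↦ u + t w`. -/
def vlift (u : TotalSpace F E) (w : E u.proj) : TangentSpace (𝓘(ℝ, B).prod 𝓘(ℝ, F)) u :=
  mfderiv 𝓘(ℝ, ℝ) (𝓘(ℝ, B).prod 𝓘(ℝ, F))
    (fun t : ℝ => TotalSpace.mk' F u.proj (u.2 + t • w)) 0 (1 : ℝ)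

variable (A) in
/-- Vertical lifts project to zero, hence belong to `V(ρ, η)TE`. -/
theorem vlift_mem (u : TotalSpace F E) (w : E u.proj) :
    ((0 : E (A.h u.proj)), vlift (B := B) u w) ∈ Prolong A u := by
  have key : mfderiv (𝓘(ℝ, B).prod 𝓘(ℝ, F)) 𝓘(ℝ, B) (π F E) u (vlift (B := B) u w) = 0 := by
    set γ : ℝ → TotalSpace F E := fun t : ℝ => TotalSpace.mk' F u.proj (u.2 + t • w) with hγ
    have h0 : γ 0 = u := by simp [hγ]
    by_cases hd : MDifferentiableAt 𝓘(ℝ, ℝ) (𝓘(ℝ, B).prod 𝓘(ℝ, F)) γ 0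
    · have hp : MDifferentiableAt (𝓘(ℝ, B).prod 𝓘(ℝ, F)) 𝓘(ℝ, B) (π F E) (γ 0) :=
        mdifferentiableAt_proj E
      have hc := mfderiv_comp (0 : ℝ) hp hd
      have hconst : (π F E) ∘ γ = fun _ : ℝ => u.proj := rfl
      rw [hconst, mfderiv_const] at hc
      have := congrArg (fun L => L (1 : ℝ)) hc
      rw [h0] at this
      exact this.symm
    · have : vlift (B := B) u w = 0 := by
        unfold vlift
        rw [mfderiv_zero_of_not_mdifferentiableAt hd]
        rfl
      rw [this, map_zero]
  simpa [Prolong] using key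

variable (A) in
/-- The Liouville section `ℂ = U^a ∂̇_a`, where `U^a (u) = y^a`. -/
def liouville : PSection A := fun u => ⟨(0, vlift u u.2), vlift_mem A u u.2⟩

/-- The almost tangent structure `J_{(g,h)}`, `X^a ∂̃_a + X̃^a ∂̇_a ↦ (g̃_a^b ∘ h ∘ π) X^a ∂̇_b`. -/
def almostTangent (g : LocInvMorphism A) (Z : PSection A) : PSection A := fun u =>
  ⟨(0, vlift u ((g.g u.proj).symm (Z.fst u))), vlift_mem A u _⟩

/-- `W` is the Lie bracket `[Z₁, Z₂]_{(ρ,η)TE}` of the generalized tangent bundle at all points of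
`D`.  The component in `TE` is the bracket of vector fields.  If, near `u`, the components in
`(h ∘ π)^* E` are `Σ a_i (e_i ∘ h ∘ π)` and `Σ b_j (e_j ∘ h ∘ π)` with sections `e_i` of `E`, then
the component of the bracket in `(h ∘ π)^* E` is given by the Leibniz rule and by
`[e_i ∘ h ∘ π, e_j ∘ h ∘ π] = [e_i, e_j]_{E,h} ∘ h ∘ π`. -/
def IsBracketOn (D : Set (TotalSpace F E)) (Z₁ Z₂ W : PSection A) : Prop :=
  ∀ u ∈ D,
    W.snd u = mlieBracket (𝓘(ℝ, B).prod 𝓘(ℝ, F)) Z₁.snd Z₂.snd u ∧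
    ∀ (n : ℕ) (e : Fin n → Cₛ^∞⟮𝓘(ℝ, B); F, E⟯) (a b : Fin n → TotalSpace F E → ℝ),
      (∀ i, MDifferentiableAt (𝓘(ℝ, B).prod 𝓘(ℝ, F)) 𝓘(ℝ, ℝ) (a i) u) →
      (∀ i, MDifferentiableAt (𝓘(ℝ, B).prod 𝓘(ℝ, F)) 𝓘(ℝ, ℝ) (b i) u) →
      (∀ᶠ v in nhds u, Z₁.fst v = ∑ i, a i v • e i (A.h v.proj)) →
      (∀ᶠ v in nhds u, Z₂.fst v = ∑ i, b i v • e i (A.h v.proj)) →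
      W.fst u =
        ∑ i, dirDeriv (𝓘(ℝ, B).prod 𝓘(ℝ, F)) (b i) u (Z₁.snd u) •
          e i (A.h u.proj) -
        ∑ i, dirDeriv (𝓘(ℝ, B).prod 𝓘(ℝ, F)) (a i) u (Z₂.snd u) •
          e i (A.h u.proj) +
        ∑ i, ∑ j, (a i u * b j u) • A.bracket (e i) (e j) (A.h u.proj)

/-- A `(ρ, η)`-connection for `E`, smooth on `D`: a left splitting `Γ : (ρ, η)TE → V(ρ, η)TE` of
the inclusion of the vertical subbundle `V(ρ, η)TE = ker (ρ, η)π!`. -/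
structure Connection (A : GenLieAlgebroid B F M E) (D : Set (TotalSpace F E)) where
  Γ : ∀ u : TotalSpace F E, Prolong A u →ₗ[ℝ] Prolong A u
  vertical : ∀ u Z, (Γ u Z).1.1 = 0
  split : ∀ u (Z : Prolong A u), Z.1.1 = 0 → Γ u Z = Z
  smooth : ∀ Z : PSection A, Z.RegularOn ⊤ D →
    PSection.RegularOn (A := A) (fun u => Γ u (Z u)) ⊤ D

/-- A mechanical `(ρ, η)`-system `((E, π, M), F_e, (ρ, η)Γ)`: an external force `F_e`, which is a
vertical section, and a `(ρ, η)`-connection. -/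
structure MechanicalSystem (A : GenLieAlgebroid B F M E) (D : Set (TotalSpace F E)) where
  force : PSection A
  force_vertical : ∀ u, force.fst u = 0
  force_smooth : force.RegularOn ⊤ D
  conn : Connection A D

/-- `S` is a `(ρ, η)`-spray of the mechanical system `𝔐` with respect to `(g, h)`; `D` is `E` or
`E` without its zero section. -/
structure IsSprayOf {D : Set (TotalSpace F E)} (𝔐 : MechanicalSystem A D) (g : LocInvMorphism A)
    (S : PSection A) : Prop where
  /-- `S` is smooth on `D` and of class `C^1` also at the zero section -/
  smooth : S.RegularOn ⊤ D
  regular_zero : S.RegularOn 1 univ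
  /-- `S` is a semispray: `J_{(g,h)} S = ℂ` -/
  semispray : almostTangent g S = liouville A
  /-- the derivation `[ℂ, S] - S` of `S` is the null section -/
  derivation : IsBracketOn univ (liouville A) S S
  /-- `S` belongs to the system: the horizontal projector `Id - Γ` of its connection is the
  horizontal projector `Z ↦ (Z + [J Z, S] - J [Z, S]) / 2` associated to `S` -/
  horizontal : ∀ Z W₁ W₂ : PSection A, Z.RegularOn ⊤ D →
    IsBracketOn D (almostTangent g Z) S W₁ → IsBracketOn D Z S W₂ →
    ∀ u ∈ D, Z u - 𝔐.conn.Γ u (Z u) = (1 / 2 : ℝ) • (Z u + W₁ u - almostTangent g W₂ u)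

/-- `S̄` is a projective change of `S`: `S̄ = S + f ℂ` with a function `f` of class `C^1` on `D`
which is 1-homogeneous, `ℂ f = f`. (The value of `f` at the zero section does not matter if this
section is not part of `D`, as `ℂ` vanishes there.) -/
def ProjectivelyRelated (D : Set (TotalSpace F E)) (S S' : PSection A) : Prop :=
  ∃ f : TotalSpace F E → ℝ,
    ContMDiffOn (𝓘(ℝ, B).prod 𝓘(ℝ, F)) 𝓘(ℝ, ℝ) 1 f D ∧
    (∀ u ∈ D, dirDeriv (𝓘(ℝ, B).prod 𝓘(ℝ, F)) f u ((liouville A).snd u) = f u) ∧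
    ∀ u, S' u = S u + f u • liouville A u

/-- On the set `I`, the curve `l` in `E` is a `(g, h)`-lift of the curve `c` in `M`: it lies over
`η ∘ h ∘ c` and `ρ ∘ g ∘ l` is the velocity of `η ∘ h ∘ c`. -/
structure IsLift (g : LocInvMorphism A) (I : Set ℝ) (c : ℝ → M) (l : ℝ → TotalSpace F E) :
    Prop where
  diff_base : ∀ t ∈ I, MDifferentiableAt 𝓘(ℝ, ℝ) 𝓘(ℝ, B) c t
  diff_lift : ∀ t ∈ I, MDifferentiableAt 𝓘(ℝ, ℝ) (𝓘(ℝ, B).prod 𝓘(ℝ, F)) l t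
  lies_over : ∀ t ∈ I, (l t).proj = A.η (A.h (c t))
  velocity : ∀ t ∈ I,
    (⟨(l t).proj, anchorAt A (l t).proj (g.g (l t).proj (l t).2)⟩ : TangentBundle 𝓘(ℝ, B) M) =
      ⟨A.η (A.h (c t)),
        mfderiv 𝓘(ℝ, ℝ) 𝓘(ℝ, B) (fun s : ℝ => A.η (A.h (c s))) t (1 : ℝ)⟩

/-- `c : I → M`, with the `(g, h)`-lift `l`, is a geodesic with respect to `S`: `I` is an open
interval, and the lift is an integral curve of `S`, that is, of the vector field `Γ(ρ̃, Id_E) S`. -/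
structure IsGeodesic (g : LocInvMorphism A) (S : PSection A) (I : Set ℝ) (c : ℝ → M)
    (l : ℝ → TotalSpace F E) : Prop where
  isOpen : IsOpen I
  interval : I.OrdConnected
  lift : IsLift g I c l
  integral : IsMIntegralCurveOn l S.snd I

/-- `φ` is a strictly increasing parameter transformation of the interval `J` onto `I`. -/
structure IsIncreasingReparam (φ : ℝ → ℝ) (J I : Set ℝ) : Prop where
  diff : DifferentiableOn ℝ φ J
  pos : ∀ s ∈ J, 0 < deriv φ s
  mono : StrictMonoOn φ J
  onto : φ '' J = I

/-- Every geodesic `c`, with lift `l`, of `S` becomes a geodesic of `S'` after a strictly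
increasing parameter transformation `φ`; the lift of `c ∘ φ` is `φ' · (l ∘ φ)`. -/
def GeodesicsReparamInto (g : LocInvMorphism A) (S S' : PSection A) : Prop :=
  ∀ (I : Set ℝ) (c : ℝ → M) (l : ℝ → TotalSpace F E), IsGeodesic g S I c l →
    ∃ (J : Set ℝ) (φ : ℝ → ℝ), IsIncreasingReparam φ J I ∧
      IsGeodesic g S' J (c ∘ φ)
        (fun s => TotalSpace.mk' F (l (φ s)).proj (deriv φ s • (l (φ s)).2))

end GenLieAlg

end

/-! Since `J S = ℂ` determines the first component of a spray, its horizontal coordinates are `ρ (g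
u)`, and two sprays differ by a vertical field. In a bundle chart with fibre coordinate `y`, the
`TE` part of `[ℂ, S] = S` is Euler's relation: the horizontal part of `S` is positively homogeneous
of degree 1 in `y`, the vertical part of degree 2 (`tcoord_scale`), and `S` vanishes on the zero
section. Geodesics are the integral curves `l` of `S`, the base curve being recovered by inverting
`η ∘ h`.

The vertical velocity of `φ' · (l ∘ φ)` is `φ'' y + φ'² S`, while `S + f ℂ` at that point has
vertical part `φ'² (S + f y)`. So a projective change is absorbed exactly by solving `φ'' = (f ∘ l ∘
φ) φ'²` (`exists_reparam`). A geodesic that meets the zero section is constant, by uniqueness of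
integral curves, and needs no change.

Conversely, comparing these velocities on the geodesic through `u ≠ 0` makes `S' - S` a multiple `f
u` of `ℂ` at `u`. Homogeneity of the sprays makes `f` 1-homogeneous. Off the zero section, `f` is a
quotient of differentiable functions; on it, where the quotient degenerates, regularity comes from
the fibrewise divergence: for `Q = f y`, the trace of `∂Q/∂y` is `(dim F + 1) f`, so `f` is `C^1`
when `Q` is `C^2` (`contDiffAt_of_smul_snd`). -/

namespace GenLieAlg

open Filter Topology

/-! ### Homogeneous factors in a vector space, and the reparametrization equation -/

section Calculus

variable {B F : Type*} [NormedAddCommGroup B] [NormedSpace ℝ B] [NormedAddCommGroup F]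
  [NormedSpace ℝ F]

/-- Near a point off the zero section, the factor `f` in `Q (x, y) = f (x, y) • y` is
differentiable if `Q` is. -/
theorem differentiableAt_of_smul_snd {V : Set B} (hV : IsOpen V) {f : B × F → ℝ}
    {Q : B × F → F} (hQ : ∀ z : B × F, z.1 ∈ V → Q z = f z • z.2) {z : B × F} (hz : z.1 ∈ V)
    (hz0 : z.2 ≠ 0) (hd : DifferentiableAt ℝ Q z) : DifferentiableAt ℝ f z := by
  -- A functional with `L y ≠ 0` recovers the factor near `z` as `L (Q w) / L w.2`.
  obtain ⟨L, hL⟩ := SeparatingDual.exists_ne_zero (R := ℝ) hz0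
  have h1 : DifferentiableAt ℝ (fun w : B × F => L (Q w) * (L w.2)⁻¹) z :=
    (L.differentiableAt.comp z hd).fun_mul
      (((L.differentiableAt (x := z.2)).comp z differentiableAt_snd).inv hL)
  refine h1.congr_of_eventuallyEq ?_
  have e1 : ∀ᶠ w : B × F in 𝓝 z, w.1 ∈ V := continuousAt_fst (hV.mem_nhds hz)
  have e2 : ∀ᶠ w : B × F in 𝓝 z, L w.2 ≠ 0 :=
    (L.continuous.comp continuous_snd).continuousAt.eventually_ne hL
  filter_upwards [e1, e2] with w hw hw'
  rw [hQ w hw, map_smul, smul_eq_mul, mul_inv_cancel_right₀ hw']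

/-- Euler's relation: `f` is the fibrewise divergence of `f (x, y) • y`, up to the factor
`dim F + 1`, if `f` is `1`-homogeneous in the fibre. -/
theorem trace_fderiv_smul_snd [FiniteDimensional ℝ F] {V : Set B} (hV : IsOpen V) {f : B × F → ℝ}
    {Q : B × F → F} (hQ : ∀ z : B × F, z.1 ∈ V → Q z = f z • z.2)
    (hf : ∀ z : B × F, z.1 ∈ V → ∀ r : ℝ, 0 < r → f (z.1, r • z.2) = r * f z)
    {z : B × F} (hz : z.1 ∈ V) (hd : DifferentiableAt ℝ Q z) :
    LinearMap.trace ℝ F ((fderiv ℝ Q z).comp (ContinuousLinearMap.inr ℝ B F)).toLinearMap =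
      (Module.finrank ℝ F + 1) * f z := by
  by_cases hz0 : z.2 = 0
  · have hfz : f z = 0 := by
      -- Scaling by 2 fixes a point of the zero section, so `f z = 2 f z`.
      have := hf z hz 2 two_pos
      rw [hz0, smul_zero, ← hz0] at this
      linarith
    have hQz : Q z = 0 := by rw [hQ z hz, hz0, smul_zero]
    -- `Q (x, t v) = t² Q (x, v)` has derivative 0 at `t = 0`. Homogeneity is available only for `t
    -- > 0`, hence the one-sided derivatives.
    have : (fderiv ℝ Q z).comp (ContinuousLinearMap.inr ℝ B F) = 0 := by
      ext v
      have hline : HasDerivAt (fun t : ℝ => z + t • ((0, v) : B × F)) ((0, v) : B × F) 0 := by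
        simpa using ((hasDerivAt_id (0 : ℝ)).smul_const ((0, v) : B × F)).const_add z
      have hd' : HasFDerivAt Q (fderiv ℝ Q z) (z + (0 : ℝ) • ((0, v) : B × F)) := by
        simpa using hd.hasFDerivAt
      have h1 := (hd'.comp_hasDerivAt 0 hline).hasDerivWithinAt (s := Ioi 0)
      have h2 : HasDerivWithinAt (fun t : ℝ => (t * t) • Q (z.1, v)) 0 (Ioi 0) 0 := by
        have := ((hasDerivAt_id (0 : ℝ)).mul (hasDerivAt_id (0 : ℝ))).smul_const (Q (z.1, v))
        simpa using this.hasDerivWithinAt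
      have h3 : HasDerivWithinAt (Q ∘ fun t : ℝ => z + t • ((0, v) : B × F)) 0 (Ioi 0) 0 := by
        refine h2.congr (fun t ht => ?_) (by simpa [← Prod.zero_eq_mk] using hQz)
        have e : z + t • ((0, v) : B × F) = (z.1, t • v) := by
          ext <;> simp [hz0]
        rw [Function.comp_apply, e, hQ (z.1, t • v) hz, hQ (z.1, v) hz, hf (z.1, v) hz t ht,
          smul_smul, smul_smul]
        congr 1
        ring
      simpa using (uniqueDiffWithinAt_Ioi (0 : ℝ)).eq_deriv _ h1 h3
    rw [this, hfz]
    simp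
  · have hfd := differentiableAt_of_smul_snd hV hQ hz hz0 hd
    have hprod : HasFDerivAt Q (f z • ContinuousLinearMap.snd ℝ B F +
        (fderiv ℝ f z).smulRight z.2) z := by
      refine (hfd.hasFDerivAt.smul hasFDerivAt_snd).congr_of_eventuallyEq ?_
      have e1 : ∀ᶠ w : B × F in 𝓝 z, w.1 ∈ V := continuousAt_fst (hV.mem_nhds hz)
      filter_upwards [e1] with w hw using hQ w hw
    have heuler : fderiv ℝ f z (0, z.2) = f z := by
      have hline : HasDerivAt (fun t : ℝ => (z.1, t • z.2)) ((0, z.2) : B × F) 1 := by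
        simpa using (hasDerivAt_const (1 : ℝ) z.1).prodMk
          ((hasDerivAt_id (1 : ℝ)).smul_const z.2)
      have hd' : HasFDerivAt f (fderiv ℝ f z) (z.1, (1 : ℝ) • z.2) := by
        simpa using hfd.hasFDerivAt
      have h1 := hd'.comp_hasDerivAt (1 : ℝ) hline
      have h2 : HasDerivAt (fun t : ℝ => t * f z) (f z) 1 := by
        simpa using (hasDerivAt_id (1 : ℝ)).mul_const (f z)
      refine h1.unique (h2.congr_of_eventuallyEq ?_)
      filter_upwards [lt_mem_nhds (zero_lt_one' ℝ)] with t ht using hf z hz t ht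
    -- The fibre derivative of `f y` is `f · id` plus the rank one map `v ↦ (∂_v f) y`; the traces
    -- are `dim F · f` and `∂_y f`, which Euler's relation identifies with `f`.
    have : ((fderiv ℝ Q z).comp (ContinuousLinearMap.inr ℝ B F)).toLinearMap =
        f z • LinearMap.id + ((fderiv ℝ f z).comp
          (ContinuousLinearMap.inr ℝ B F)).toLinearMap.smulRight z.2 := by
      rw [hprod.fderiv]
      ext v
      simp
    rw [this, map_add, map_smul, LinearMap.trace_id, LinearMap.trace_smulRight]
    simp only [ContinuousLinearMap.coe_coe, ContinuousLinearMap.comp_apply,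
      ContinuousLinearMap.inr_apply, heuler, smul_eq_mul]
    ring

/-- If `f (x, y) • y` is smooth with `f` positively `1`-homogeneous in `y`, then `f` is `C^1`, even
on the zero section. -/
theorem contDiffAt_of_smul_snd [FiniteDimensional ℝ F] {V : Set B} (hV : IsOpen V)
    {f : B × F → ℝ} {Q : B × F → F} (hQ : ∀ z : B × F, z.1 ∈ V → Q z = f z • z.2)
    (hf : ∀ z : B × F, z.1 ∈ V → ∀ r : ℝ, 0 < r → f (z.1, r • z.2) = r * f z)
    {z : B × F} (hz : z.1 ∈ V) (hd : ContDiffAt ℝ 2 Q z) : ContDiffAt ℝ 1 f z := by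
  let T : (F →L[ℝ] F) →ₗ[ℝ] ℝ := (LinearMap.trace ℝ F).comp (ContinuousLinearMap.coeLM ℝ)
  have hT : ContDiffAt ℝ 1 (fun w => ((Module.finrank ℝ F + 1 : ℝ))⁻¹ *
      T.toContinuousLinearMap ((fderiv ℝ Q w).comp (ContinuousLinearMap.inr ℝ B F))) z := by
    refine contDiffAt_const.mul (T.toContinuousLinearMap.contDiff.contDiffAt.comp z ?_)
    exact (hd.fderiv_right (by norm_num)).clm_comp contDiffAt_const
  refine hT.congr_of_eventuallyEq ?_
  have e1 : ∀ᶠ w : B × F in 𝓝 z, w.1 ∈ V := continuousAt_fst (hV.mem_nhds hz)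
  filter_upwards [e1, hd.eventually (by simp)] with w hw hdw
  have := trace_fderiv_smul_snd hV hQ hf hw (hdw.differentiableAt (by simp))
  change f w = _ * LinearMap.trace ℝ F
    ((fderiv ℝ Q w).comp (ContinuousLinearMap.inr ℝ B F)).toLinearMap
  rw [this, inv_mul_cancel_left₀ (by positivity)]

/-- The reparametrizations with `φ'' = (k ∘ φ) φ' ^ 2`. -/
theorem exists_reparam {I : Set ℝ} (hI : IsOpen I) (hI' : I.OrdConnected) {k : ℝ → ℝ}
    (hk : ContinuousOn k I) :
    ∃ (J : Set ℝ) (φ : ℝ → ℝ), IsOpen J ∧ J.OrdConnected ∧ IsIncreasingReparam φ J I ∧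
      ∀ s ∈ J, HasDerivAt (deriv φ) (deriv φ s ^ 2 * k (φ s)) s := by
  rcases I.eq_empty_or_nonempty with rfl | ⟨t₀, ht₀⟩
  · exact ⟨∅, id, isOpen_empty, ordConnected_empty,
      ⟨differentiableOn_empty, fun _ h => h.elim, fun _ h => h.elim, image_empty _⟩, by simp⟩
  have prim : ∀ q : ℝ → ℝ, ContinuousOn q I → ∀ t ∈ I,
      HasDerivAt (fun t => ∫ x in t₀..t, q x) (q t) t := by
    intro q hq t ht
    have hc : ContinuousAt q t := hq.continuousAt (hI.mem_nhds ht)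
    refine intervalIntegral.integral_hasDerivAt_right
      ((hq.mono (hI'.uIcc_subset ht₀ ht)).intervalIntegrable) ?_ hc
    exact hq.stronglyMeasurableAtFilter hI t ht
  set K : ℝ → ℝ := fun t => ∫ x in t₀..t, k x
  -- For the inverse `ψ` of `φ` the equation becomes linear, `ψ'' = -k ψ'`. So `ψ` is a primitive of
  -- `exp (-∫ k)`, and `φ` is obtained by inverting it on `I`.
  set p : ℝ → ℝ := fun t => Real.exp (-K t) with hp
  have hp' : ∀ t ∈ I, HasDerivAt p (-k t * p t) t := by
    intro t ht
    have := (prim k hk t ht).neg.exp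
    rwa [mul_comm] at this
  have hpc : ContinuousOn p I := fun t ht => (hp' t ht).continuousAt.continuousWithinAt
  have hpos : ∀ t, 0 < p t := fun t => Real.exp_pos _
  set ψ : ℝ → ℝ := fun t => ∫ x in t₀..t, p x
  have hψ : ∀ t ∈ I, HasDerivAt ψ (p t) t := prim p hpc
  have hψc : ContinuousOn ψ I := fun t ht => (hψ t ht).continuousAt.continuousWithinAt
  have hmono : StrictMonoOn ψ I := by
    refine strictMonoOn_of_deriv_pos hI'.convex hψc fun t ht => ?_
    rw [(hψ t (interior_subset ht)).deriv]
    exact hpos t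
  have hinj := hmono.injOn
  set φ := Function.invFunOn ψ I with hφ
  have hφψ : ∀ t ∈ I, φ (ψ t) = t := fun t ht => hinj.leftInvOn_invFunOn ht
  have hJ : IsOpen (ψ '' I) := by
    rw [isOpen_iff_mem_nhds]
    rintro _ ⟨t, ht, rfl⟩
    have hs : HasStrictDerivAt ψ (p t) t := by
      refine hasStrictDerivAt_of_hasDerivAt_of_continuousAt (f' := p) ?_
        (hpc.continuousAt (hI.mem_nhds ht))
      filter_upwards [hI.mem_nhds ht] with x hx using hψ x hx
    rw [← hs.map_nhds_eq (hpos t).ne']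
    exact image_mem_map (hI.mem_nhds ht)
  have honto : φ '' (ψ '' I) = I := by
    rw [image_image]
    exact (image_congr hφψ).trans (image_id I)
  have hφm : StrictMonoOn φ (ψ '' I) := by
    rintro _ ⟨a, ha, rfl⟩ _ ⟨b, hb, rfl⟩ hab
    rw [hφψ a ha, hφψ b hb]
    exact (hmono.lt_iff_lt ha hb).1 hab
  have hφd : ∀ s ∈ ψ '' I, HasDerivAt φ (p (φ s))⁻¹ s := by
    rintro _ ⟨t, ht, rfl⟩
    have ht' : φ (ψ t) ∈ I := by rwa [hφψ t ht]
    refine HasDerivAt.of_local_left_inverse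
      (hφm.continuousAt_of_image_mem_nhds (hJ.mem_nhds (mem_image_of_mem _ ht)) ?_)
      (hψ _ ht') (hpos _).ne' ?_
    · rw [honto]
      exact hI.mem_nhds ht'
    · filter_upwards [hJ.mem_nhds (mem_image_of_mem _ ht)] with s hs
      exact Function.invFunOn_eq hs
  refine ⟨ψ '' I, φ, hJ, ?_, ⟨fun s hs => (hφd s hs).differentiableAt.differentiableWithinAt,
    fun s hs => ?_, hφm, honto⟩, fun s hs => ?_⟩
  · exact (hI'.isPreconnected.image ψ hψc).ordConnected
  · rw [(hφd s hs).deriv]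
    exact inv_pos.2 (hpos _)
  · have hsI : φ s ∈ I := honto ▸ mem_image_of_mem φ hs
    have h1 : HasDerivAt (fun s => (p (φ s))⁻¹) (deriv φ s ^ 2 * k (φ s)) s := by
      have := (HasDerivAt.comp s (hp' _ hsI) (hφd s hs)).inv (hpos _).ne'
      refine this.congr_deriv ?_
      rw [(hφd s hs).deriv]
      have := (hpos (φ s)).ne'
      simp only [Function.comp_apply]
      field_simp
    refine h1.congr_of_eventuallyEq ?_
    filter_upwards [hJ.mem_nhds hs] with x hx using (hφd x hx).deriv

end Calculus

/-! ### Bundle charts of the total space, and scaling in the fibres -/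

section Coordinates

variable {B : Type*} [NormedAddCommGroup B] [NormedSpace ℝ B]
  {F : Type*} [NormedAddCommGroup F] [NormedSpace ℝ F]
  {M : Type*} [TopologicalSpace M] [ChartedSpace B M]
  {E : M → Type*} [∀ x, TopologicalSpace (E x)]
  [TopologicalSpace (TotalSpace F E)] [FiberBundle F E]

/-- A tangent vector of the total space, in the coordinates of the preferred chart. -/
def tcoord {u : TotalSpace F E} (v : TangentSpace (𝓘(ℝ, B).prod 𝓘(ℝ, F)) u) : B × F := v

/-- A vector field on the total space, in the coordinates of the chart at `b`. -/
noncomputable def chartField (V : ∀ u : TotalSpace F E, TangentSpace (𝓘(ℝ, B).prod 𝓘(ℝ, F)) u)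
    (b : TotalSpace F E) : B × F → B × F :=
  mpullbackWithin 𝓘(ℝ, B × F) (𝓘(ℝ, B).prod 𝓘(ℝ, F)) (extChartAt (𝓘(ℝ, B).prod 𝓘(ℝ, F)) b).symm V
    (range (𝓘(ℝ, B).prod 𝓘(ℝ, F)))

/-- The preferred chart of the total space is built from data at the projection alone, so one chart
serves along a whole ray `scale r u`. -/
theorem extChartAt_eq_of_proj {b u : TotalSpace F E} (h : b.proj = u.proj) :
    extChartAt (𝓘(ℝ, B).prod 𝓘(ℝ, F)) b = extChartAt (𝓘(ℝ, B).prod 𝓘(ℝ, F)) u := by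
  rw [FiberBundle.extChartAt, FiberBundle.extChartAt, h]

theorem chartField_eq_of_proj
    (V : ∀ u : TotalSpace F E, TangentSpace (𝓘(ℝ, B).prod 𝓘(ℝ, F)) u) {b u : TotalSpace F E}
    (h : b.proj = u.proj) : chartField V b = chartField V u := by
  unfold chartField
  rw [extChartAt_eq_of_proj h]

theorem extChartAt_mk (b : TotalSpace F E) {x : M}
    (hx : x ∈ (trivializationAt F E b.proj).baseSet) (w : E x) :
    extChartAt (𝓘(ℝ, B).prod 𝓘(ℝ, F)) b (TotalSpace.mk' F x w) =
      (extChartAt 𝓘(ℝ, B) b.proj x, (trivializationAt F E b.proj (TotalSpace.mk' F x w)).2) := by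
  rw [FiberBundle.extChartAt]
  have := (trivializationAt F E b.proj).coe_fst' (x := TotalSpace.mk' F x w) hx
  ext
  · change extChartAt 𝓘(ℝ, B) b.proj (trivializationAt F E b.proj (TotalSpace.mk' F x w)).1 = _
    rw [this]
  · rfl

theorem mem_extChartAt_source_iff {b u : TotalSpace F E} :
    u ∈ (extChartAt (𝓘(ℝ, B).prod 𝓘(ℝ, F)) b).source ↔
      u.proj ∈ (trivializationAt F E b.proj).baseSet ∧ u.proj ∈ (chartAt B b.proj).source := by
  rw [FiberBundle.extChartAt]
  have h : ∀ hu : u.proj ∈ (trivializationAt F E b.proj).baseSet,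
      (trivializationAt F E b.proj u).1 = u.proj := fun hu =>
    (trivializationAt F E b.proj).coe_fst' (x := u) hu
  simp only [PartialEquiv.trans_source, mem_inter_iff, PartialEquiv.prod_source, mem_preimage,
    mem_prod, extChartAt_source, PartialEquiv.refl_source, mem_univ, and_true]
  change u ∈ (trivializationAt F E b.proj).source ∧
    (trivializationAt F E b.proj u).1 ∈ _ ↔ _
  rw [Trivialization.mem_source]
  exact and_congr_right fun hu => by rw [h hu]

/-- The fibre coordinate of `u`. -/
def fcoord (u : TotalSpace F E) : F := (trivializationAt F E u.proj u).2

theorem extChartAt_self_snd (u : TotalSpace F E) :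
    (extChartAt (𝓘(ℝ, B).prod 𝓘(ℝ, F)) u u).2 = fcoord u :=
  congrArg Prod.snd (extChartAt_mk (B := B) u (mem_baseSet_trivializationAt F E u.proj) u.2)

/-- Tangent vectors at `l t` are stored as coordinates in the chart preferred at `l t`, so
velocities of curves become ordinary derivatives. -/
theorem hasMFDerivAt_curve_iff {l : ℝ → TotalSpace F E} {t : ℝ}
    {v : TangentSpace (𝓘(ℝ, B).prod 𝓘(ℝ, F)) (l t)} :
    HasMFDerivAt 𝓘(ℝ, ℝ) (𝓘(ℝ, B).prod 𝓘(ℝ, F)) l t ((1 : ℝ →L[ℝ] ℝ).smulRight v) ↔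
      ContinuousAt l t ∧
        HasDerivAt (extChartAt (𝓘(ℝ, B).prod 𝓘(ℝ, F)) (l t) ∘ l) (tcoord v) t := by
  refine and_congr_right fun _ => ?_
  have h : ∀ L : ℝ →L[ℝ] B × F, HasFDerivWithinAt
      (writtenInExtChartAt 𝓘(ℝ, ℝ) (𝓘(ℝ, B).prod 𝓘(ℝ, F)) t l) L (range 𝓘(ℝ, ℝ))
      (extChartAt 𝓘(ℝ, ℝ) t t) ↔
      HasFDerivAt (extChartAt (𝓘(ℝ, B).prod 𝓘(ℝ, F)) (l t) ∘ l) L t := by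
    intro L
    simp only [writtenInExtChartAt, mfld_simps]
    exact hasFDerivWithinAt_univ
  refine (h _).trans ?_
  rw [hasDerivAt_iff_hasFDerivAt]
  rfl

/-- Bundle charts lie over base charts, so the projection reads as `Prod.fst`. -/
theorem mfderiv_proj_apply (u : TotalSpace F E) (v : TangentSpace (𝓘(ℝ, B).prod 𝓘(ℝ, F)) u) :
    (mfderiv (𝓘(ℝ, B).prod 𝓘(ℝ, F)) 𝓘(ℝ, B) (π F E) u v : B) = (tcoord v).1 := by
  have hd : MDifferentiableAt (𝓘(ℝ, B).prod 𝓘(ℝ, F)) 𝓘(ℝ, B) (π F E) u :=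
    mdifferentiableAt_proj E
  have he : writtenInExtChartAt (𝓘(ℝ, B).prod 𝓘(ℝ, F)) 𝓘(ℝ, B) u (π F E) =ᶠ[𝓝
      (extChartAt (𝓘(ℝ, B).prod 𝓘(ℝ, F)) u u)] Prod.fst := by
    filter_upwards [extChartAt_target_mem_nhds (I := 𝓘(ℝ, B).prod 𝓘(ℝ, F)) u] with z hz
    have h1 := (extChartAt (𝓘(ℝ, B).prod 𝓘(ℝ, F)) u).map_target hz
    have h2 := extChartAt_mk (B := B) u (mem_extChartAt_source_iff.1 h1).1
      ((extChartAt (𝓘(ℝ, B).prod 𝓘(ℝ, F)) u).symm z).2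
    have h3 := (extChartAt (𝓘(ℝ, B).prod 𝓘(ℝ, F)) u).right_inv hz
    exact (congrArg Prod.fst (h2.symm.trans h3))
  have h1 : HasFDerivAt (writtenInExtChartAt (𝓘(ℝ, B).prod 𝓘(ℝ, F)) 𝓘(ℝ, B) u (π F E))
      (ContinuousLinearMap.fst ℝ B F) (extChartAt (𝓘(ℝ, B).prod 𝓘(ℝ, F)) u u) :=
    hasFDerivAt_fst.congr_of_eventuallyEq he
  have h2 : ∀ L : B × F →L[ℝ] B, HasFDerivWithinAt
      (writtenInExtChartAt (𝓘(ℝ, B).prod 𝓘(ℝ, F)) 𝓘(ℝ, B) u (π F E)) L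
      (range (𝓘(ℝ, B).prod 𝓘(ℝ, F))) (extChartAt (𝓘(ℝ, B).prod 𝓘(ℝ, F)) u u) →
      L v = (tcoord v).1 := by
    intro L hL
    rw [ModelWithCorners.range_eq_univ, hasFDerivWithinAt_univ] at hL
    rw [hL.unique h1]
    rfl
  exact h2 _ hd.hasMFDerivAt.2

variable [∀ x, AddCommGroup (E x)] [∀ x, Module ℝ (E x)] [VectorBundle ℝ F E]

/-- The point `r u` of the fibre through `u`. -/
def scale (r : ℝ) (u : TotalSpace F E) : TotalSpace F E := TotalSpace.mk' F u.proj (r • u.2)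

theorem trivialization_scale (e : Trivialization F (π F E)) [MemTrivializationAtlas e]
    {u : TotalSpace F E} (hu : u.proj ∈ e.baseSet) (r : ℝ) :
    (e (scale r u)).2 = r • (e u).2 :=
  (e.linear ℝ hu).map_smul r u.2

theorem extChartAt_scale {b u : TotalSpace F E}
    (hu : u.proj ∈ (trivializationAt F E b.proj).baseSet) (r : ℝ) :
    extChartAt (𝓘(ℝ, B).prod 𝓘(ℝ, F)) b (scale r u) =
      (extChartAt 𝓘(ℝ, B) b.proj u.proj, r • (trivializationAt F E b.proj u).2) := by
  rw [← trivialization_scale _ hu]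
  exact extChartAt_mk b hu _

theorem trivialization_add_smul {u : TotalSpace F E} {w : E u.proj}
    (e : Trivialization F (π F E)) [MemTrivializationAtlas e] (he : u.proj ∈ e.baseSet) (t : ℝ) :
    (e (TotalSpace.mk' F u.proj (u.2 + t • w))).2 =
      (e (TotalSpace.mk' F u.proj u.2)).2 + t • (e (TotalSpace.mk' F u.proj w)).2 := by
  have := (e.linear ℝ he).map_add u.2 (t • w)
  rw [(e.linear ℝ he).map_smul] at this
  exact this

theorem mdifferentiableAt_add_smul (u : TotalSpace F E) (w : E u.proj) :
    MDifferentiableAt 𝓘(ℝ, ℝ) (𝓘(ℝ, B).prod 𝓘(ℝ, F))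
      (fun t : ℝ => TotalSpace.mk' F u.proj (u.2 + t • w)) 0 := by
  rw [mdifferentiableAt_totalSpace]
  refine ⟨mdifferentiableAt_const, ?_⟩
  change MDifferentiableAt _ _ (fun t : ℝ => (trivializationAt F E u.proj
    (TotalSpace.mk' F u.proj (u.2 + t • w))).2) 0
  rw [funext (trivialization_add_smul (trivializationAt F E u.proj)
    (mem_baseSet_trivializationAt F E u.proj))]
  exact (((differentiable_id.smul_const _).const_add _) 0).mdifferentiableAt

/-- The derivative of a positively `1`-homogeneous function along the Liouville section. -/
theorem dirDeriv_vlift_self {f : TotalSpace F E → ℝ} {u : TotalSpace F E}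
    (hd : MDifferentiableAt (𝓘(ℝ, B).prod 𝓘(ℝ, F)) 𝓘(ℝ, ℝ) f u)
    (hf : ∀ r : ℝ, 0 < r → f (scale r u) = r * f u) :
    dirDeriv (𝓘(ℝ, B).prod 𝓘(ℝ, F)) f u (vlift u u.2) = f u := by
  set γ : ℝ → TotalSpace F E := fun t => TotalSpace.mk' F u.proj (u.2 + t • u.2) with hγ
  have h0 : γ 0 = u := by simp [hγ]
  have hd0 : MDifferentiableAt (𝓘(ℝ, B).prod 𝓘(ℝ, F)) 𝓘(ℝ, ℝ) f (γ 0) := by rwa [h0]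
  have hc := mfderiv_comp (0 : ℝ) hd0 (mdifferentiableAt_add_smul u u.2)
  have hder : HasDerivAt (f ∘ γ) (f u) 0 := by
    have h1 : HasDerivAt (fun t : ℝ => (1 + t) * f u) (f u) 0 := by
      simpa using ((hasDerivAt_id (0 : ℝ)).const_add 1).mul_const (f u)
    refine h1.congr_of_eventuallyEq ?_
    -- The curve is `(1 + t) u`, and positive homogeneity applies once `1 + t > 0`.
    filter_upwards [lt_mem_nhds (show (-1 : ℝ) < 0 by norm_num)] with t ht
    have : γ t = scale (1 + t) u := by simp [hγ, scale, add_smul]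
    rw [Function.comp_apply, this, hf _ (by linarith)]
  have h1 := congrArg (fun L => L (1 : ℝ)) hc
  rw [mfderiv_eq_fderiv] at h1
  have h2 : fderiv ℝ (f ∘ γ) 0 1 = f u := by
    rw [hder.hasFDerivAt.fderiv]
    simp
  have h3 := h2.symm.trans h1
  rw [h0] at h3
  exact h3.symm

end Coordinates

/-! ### Vector fields, vertical lifts and brackets in a bundle chart -/

section VectorFields

variable {B : Type*} [NormedAddCommGroup B] [NormedSpace ℝ B]
  {F : Type*} [NormedAddCommGroup F] [NormedSpace ℝ F]
  {M : Type*} [TopologicalSpace M] [ChartedSpace B M] [IsManifold 𝓘(ℝ, B) ∞ M]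
  {E : M → Type*} [∀ x, AddCommGroup (E x)] [∀ x, Module ℝ (E x)] [∀ x, TopologicalSpace (E x)]
  [TopologicalSpace (TotalSpace F E)] [FiberBundle F E] [VectorBundle ℝ F E]
  [ContMDiffVectorBundle ∞ F E 𝓘(ℝ, B)]

/-- A trivialization is linear on fibres, so it carries `t ↦ u + t w` to a straight line in the
fibre direction. The chart at a nearby `b` is allowed, because brackets differentiate fields in a
fixed chart. -/
theorem mfderiv_extChartAt_vlift {b u : TotalSpace F E}
    (hu : u ∈ (extChartAt (𝓘(ℝ, B).prod 𝓘(ℝ, F)) b).source) (w : E u.proj) :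
    (mfderiv (𝓘(ℝ, B).prod 𝓘(ℝ, F)) 𝓘(ℝ, B × F) (extChartAt (𝓘(ℝ, B).prod 𝓘(ℝ, F)) b) u
      (vlift u w) : B × F) =
      (0, (trivializationAt F E b.proj (TotalSpace.mk' F u.proj w)).2) := by
  set γ : ℝ → TotalSpace F E := fun t => TotalSpace.mk' F u.proj (u.2 + t • w) with hγ
  have h0 : γ 0 = u := by simp [hγ]
  obtain ⟨hb, hc⟩ := mem_extChartAt_source_iff.1 hu
  have hlin := trivialization_add_smul (u := u) (w := w) (trivializationAt F E b.proj) hb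
  have hγd : MDifferentiableAt 𝓘(ℝ, ℝ) (𝓘(ℝ, B).prod 𝓘(ℝ, F)) γ 0 := mdifferentiableAt_add_smul u w
  have hκ : MDifferentiableAt (𝓘(ℝ, B).prod 𝓘(ℝ, F)) 𝓘(ℝ, B × F)
      (extChartAt (𝓘(ℝ, B).prod 𝓘(ℝ, F)) b) (γ 0) := by
    rw [h0]
    exact mdifferentiableAt_extChartAt (by rwa [← extChartAt_source (𝓘(ℝ, B).prod 𝓘(ℝ, F))])
  have hcomp := mfderiv_comp (0 : ℝ) hκ hγd
  have hfun : extChartAt (𝓘(ℝ, B).prod 𝓘(ℝ, F)) b ∘ γ = fun t : ℝ =>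
      (extChartAt 𝓘(ℝ, B) b.proj u.proj,
        (trivializationAt F E b.proj (TotalSpace.mk' F u.proj u.2)).2 +
          t • (trivializationAt F E b.proj (TotalSpace.mk' F u.proj w)).2) := by
    funext t
    rw [← hlin t]
    exact extChartAt_mk b hb _
  have hder : HasDerivAt (extChartAt (𝓘(ℝ, B).prod 𝓘(ℝ, F)) b ∘ γ)
      ((0, (trivializationAt F E b.proj (TotalSpace.mk' F u.proj w)).2) : B × F) 0 := by
    rw [hfun]
    have := ((hasDerivAt_id (0 : ℝ)).smul_const
      (trivializationAt F E b.proj (TotalSpace.mk' F u.proj w)).2).const_add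
      (trivializationAt F E b.proj (TotalSpace.mk' F u.proj u.2)).2
    simpa using (hasDerivAt_const (0 : ℝ) (extChartAt 𝓘(ℝ, B) b.proj u.proj)).prodMk this
  have h1 := congrArg (fun L => L (1 : ℝ)) hcomp
  rw [mfderiv_eq_fderiv] at h1
  have h2 : fderiv ℝ (extChartAt (𝓘(ℝ, B).prod 𝓘(ℝ, F)) b ∘ γ) 0 1 =
      ((0, (trivializationAt F E b.proj (TotalSpace.mk' F u.proj w)).2) : B × F) := by
    rw [hder.hasFDerivAt.fderiv]
    simp
  have h3 := h2.symm.trans h1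
  rw [h0] at h3
  exact h3.symm

theorem tcoord_vlift (u : TotalSpace F E) (w : E u.proj) :
    tcoord (B := B) (vlift u w) =
      (0, (trivializationAt F E u.proj (TotalSpace.mk' F u.proj w)).2) := by
  rw [← mfderiv_extChartAt_vlift (B := B) (mem_extChartAt_source u) w, mfderiv_extChartAt_self]
  rfl

/-- The pull-back inverts the derivative of the inverse chart, and that inverse is the derivative of
the chart. -/
theorem chartField_apply (V : ∀ u : TotalSpace F E, TangentSpace (𝓘(ℝ, B).prod 𝓘(ℝ, F)) u)
    (b : TotalSpace F E) {z : B × F}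
    (hz : z ∈ (extChartAt (𝓘(ℝ, B).prod 𝓘(ℝ, F)) b).target) :
    chartField V b z = mfderiv (𝓘(ℝ, B).prod 𝓘(ℝ, F)) 𝓘(ℝ, B × F)
      (extChartAt (𝓘(ℝ, B).prod 𝓘(ℝ, F)) b) ((extChartAt (𝓘(ℝ, B).prod 𝓘(ℝ, F)) b).symm z)
      (V ((extChartAt (𝓘(ℝ, B).prod 𝓘(ℝ, F)) b).symm z)) := by
  have h := ContinuousLinearMap.inverse_eq
    (mfderivWithin_extChartAt_symm_comp_mfderiv_extChartAt (I := 𝓘(ℝ, B).prod 𝓘(ℝ, F)) hz)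
    (mfderiv_extChartAt_comp_mfderivWithin_extChartAt_symm hz)
  exact congrArg (fun L => L (V ((extChartAt (𝓘(ℝ, B).prod 𝓘(ℝ, F)) b).symm z))) h

theorem chartField_extChartAt
    (V : ∀ u : TotalSpace F E, TangentSpace (𝓘(ℝ, B).prod 𝓘(ℝ, F)) u)
    {b u : TotalSpace F E} (h : b.proj = u.proj) :
    chartField V b (extChartAt (𝓘(ℝ, B).prod 𝓘(ℝ, F)) b u) = tcoord (V u) := by
  have key : ∀ p, p = u → (mfderiv (𝓘(ℝ, B).prod 𝓘(ℝ, F)) 𝓘(ℝ, B × F)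
      (extChartAt (𝓘(ℝ, B).prod 𝓘(ℝ, F)) u) p (V p) : B × F) = tcoord (V u) := by
    rintro _ rfl
    rw [mfderiv_extChartAt_self]
    rfl
  rw [chartField_eq_of_proj V h, extChartAt_eq_of_proj h, chartField_apply _ _ (mem_extChartAt_target u)]
  exact key _ (extChartAt_to_inv u)

theorem chartField_vlift (b : TotalSpace F E) {z : B × F}
    (hz : z ∈ (extChartAt (𝓘(ℝ, B).prod 𝓘(ℝ, F)) b).target) :
    chartField (fun u => vlift u u.2) b z = (0, z.2) := by
  have hs := (extChartAt (𝓘(ℝ, B).prod 𝓘(ℝ, F)) b).map_target hz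
  have h1 := extChartAt_mk (B := B) b (mem_extChartAt_source_iff.1 hs).1
      ((extChartAt (𝓘(ℝ, B).prod 𝓘(ℝ, F)) b).symm z).2
  have h2 := (extChartAt (𝓘(ℝ, B).prod 𝓘(ℝ, F)) b).right_inv hz
  rw [chartField_apply _ _ hz, mfderiv_extChartAt_vlift hs]
  exact congrArg (fun q : B × F => ((0 : B), q.2)) (h1.symm.trans h2)

theorem contDiffAt_chartField [CompleteSpace B] [CompleteSpace F] {n : ℕ}
    {V : ∀ u : TotalSpace F E, TangentSpace (𝓘(ℝ, B).prod 𝓘(ℝ, F)) u} {u : TotalSpace F E}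
    (hV : ContMDiffAt (𝓘(ℝ, B).prod 𝓘(ℝ, F)) (𝓘(ℝ, B).prod 𝓘(ℝ, F)).tangent n
      (fun u => (⟨u, V u⟩ : TangentBundle (𝓘(ℝ, B).prod 𝓘(ℝ, F)) (TotalSpace F E))) u) :
    ContDiffAt ℝ n (chartField V u) (extChartAt (𝓘(ℝ, B).prod 𝓘(ℝ, F)) u u) := by
  have hn : (n : ℕ∞ω) + 1 ≤ ∞ := by exact_mod_cast le_top
  have := contMDiffWithinAt_mpullbackWithin_extChartAt_symm (n := ∞) (s := univ) (x := u)
    (hV.contMDiffWithinAt) uniqueMDiffOn_univ (mem_univ _) hn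
  rw [preimage_univ, inter_univ, contMDiffWithinAt_vectorSpace_iff_contDiffWithinAt] at this
  exact this.contDiffAt (extChartAt_target_mem_nhds u)

/-- The manifold bracket is the bracket of the chart fields transported back by the derivative of
the chart at its own centre, which is the identity. -/
theorem mlieBracket_eq_chartField
    (V W : ∀ u : TotalSpace F E, TangentSpace (𝓘(ℝ, B).prod 𝓘(ℝ, F)) u) (u : TotalSpace F E) :
    tcoord (mlieBracket (𝓘(ℝ, B).prod 𝓘(ℝ, F)) V W u) =
      lieBracket ℝ (chartField V u) (chartField W u)
        (extChartAt (𝓘(ℝ, B).prod 𝓘(ℝ, F)) u u) := by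
  have hL : @Eq ((B × F) →L[ℝ] (B × F)) (mfderiv (𝓘(ℝ, B).prod 𝓘(ℝ, F)) 𝓘(ℝ, B × F)
      (extChartAt (𝓘(ℝ, B).prod 𝓘(ℝ, F)) u) u) (ContinuousLinearMap.id ℝ (B × F)) :=
    mfderiv_extChartAt_self
  have hi : ∀ L : (B × F) →L[ℝ] (B × F), L = ContinuousLinearMap.id ℝ (B × F) →
      ∀ X : B × F, L.inverse X = X := by
    rintro _ rfl X
    rw [ContinuousLinearMap.inverse_id]
    rfl
  refine (hi _ hL _).trans ?_
  rw [preimage_univ, univ_inter]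
  change lieBracketWithin ℝ (chartField V u) (chartField W u) _ _ = _
  rw [ModelWithCorners.range_eq_univ, lieBracketWithin_univ]

end VectorFields

/-! ### From `[ℂ, V] = V` to homogeneity in the fibres -/

section Homogeneity

/-- Solutions of Euler's equation on the positive half-line are homogeneous. -/
theorem eq_pow_smul_of_euler {X : Type*} [NormedAddCommGroup X] [NormedSpace ℝ X] (k : ℕ)
    {c c' : ℝ → X} (hc : ∀ r, 0 < r → HasDerivAt c (c' r) r)
    (he : ∀ r, 0 < r → r • c' r = (k : ℝ) • c r) {r : ℝ} (hr : 0 < r) : c r = r ^ k • c 1 := by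
  -- By Euler's equation `s⁻ᵏ c s` has zero derivative, hence is constant.
  have hd : ∀ s ∈ Ioi (0 : ℝ), HasDerivAt (fun s => (s ^ k)⁻¹ • c s) 0 s := by
    intro s hs
    have hs0 : s ≠ 0 := ne_of_gt hs
    have h1 := ((hasDerivAt_pow k s).fun_inv (pow_ne_zero k hs0)).fun_smul (hc s hs)
    refine h1.congr_deriv ?_
    have h2 : c' s = s⁻¹ • (k : ℝ) • c s := by
      rw [← he s hs, inv_smul_smul₀ hs0]
    rw [h2, smul_smul, smul_smul, ← add_smul]
    convert zero_smul ℝ (c s) using 2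
    rcases k with _ | k
    · simp
    · rw [Nat.add_sub_cancel]
      field_simp
      ring
  have h2 : (r ^ k)⁻¹ • c r = ((1 : ℝ) ^ k)⁻¹ • c 1 :=
    isOpen_Ioi.is_const_of_deriv_eq_zero isPreconnected_Ioi
      (fun s hs => (hd s hs).differentiableAt.differentiableWithinAt)
      (fun s hs => (hd s hs).deriv) hr (mem_Ioi.2 one_pos)
  rw [one_pow, inv_one, one_smul] at h2
  rw [← h2, smul_inv_smul₀ (pow_ne_zero k hr.ne')]

variable {B : Type*} [NormedAddCommGroup B] [NormedSpace ℝ B]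
  {F : Type*} [NormedAddCommGroup F] [NormedSpace ℝ F]
  {M : Type*} [TopologicalSpace M] [ChartedSpace B M] [IsManifold 𝓘(ℝ, B) ∞ M]
  {E : M → Type*} [∀ x, AddCommGroup (E x)] [∀ x, Module ℝ (E x)] [∀ x, TopologicalSpace (E x)]
  [TopologicalSpace (TotalSpace F E)] [FiberBundle F E] [VectorBundle ℝ F E]
  [ContMDiffVectorBundle ∞ F E 𝓘(ℝ, B)]

/-- In the chart `ℂ` is the linear field `(0, y)`, so `[ℂ, V] = DV (0, y) - (0, V₂)`. Equating this
with `V` doubles the fibre component only, whence the degrees 1 and 2. -/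
theorem fderiv_chartField_vertical [CompleteSpace B] [CompleteSpace F]
    {V : ∀ u : TotalSpace F E, TangentSpace (𝓘(ℝ, B).prod 𝓘(ℝ, F)) u} {u : TotalSpace F E}
    (hb : V u = mlieBracket (𝓘(ℝ, B).prod 𝓘(ℝ, F)) (fun u => vlift u u.2) V u) :
    fderiv ℝ (chartField V u) (extChartAt (𝓘(ℝ, B).prod 𝓘(ℝ, F)) u u)
      (0, (trivializationAt F E u.proj u).2) =
      ((tcoord (V u)).1, (2 : ℝ) • (tcoord (V u)).2) := by
  have h1 : tcoord (V u) = _ := (congrArg tcoord hb).trans (mlieBracket_eq_chartField _ _ u)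
  have he : chartField (B := B) (fun u : TotalSpace F E => vlift u u.2) u =ᶠ[𝓝
      (extChartAt (𝓘(ℝ, B).prod 𝓘(ℝ, F)) u u)]
      (ContinuousLinearMap.inr ℝ B F).comp (ContinuousLinearMap.snd ℝ B F) := by
    filter_upwards [extChartAt_target_mem_nhds (I := 𝓘(ℝ, B).prod 𝓘(ℝ, F)) u] with z hz
    exact chartField_vlift u hz
  have hz : (extChartAt (𝓘(ℝ, B).prod 𝓘(ℝ, F)) u u).2 = (trivializationAt F E u.proj u).2 :=
    congrArg Prod.snd (extChartAt_mk (B := B) u (mem_baseSet_trivializationAt F E u.proj) u.2)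
  rw [he.lieBracket_vectorField_eq EventuallyEq.rfl, lieBracket, ContinuousLinearMap.fderiv,
    chartField_extChartAt V rfl] at h1
  simp only [ContinuousLinearMap.comp_apply, ContinuousLinearMap.inr_apply,
    ContinuousLinearMap.coe_snd', hz] at h1
  have h2 := eq_add_of_sub_eq h1.symm
  rw [h2]
  ext
  · simp
  · simp [two_smul]

/-- At `y = 0` Euler's relation reads `0 = (V₁, 2 V₂)`. -/
theorem tcoord_eq_zero_of_bracket [CompleteSpace B] [CompleteSpace F]
    {V : ∀ u : TotalSpace F E, TangentSpace (𝓘(ℝ, B).prod 𝓘(ℝ, F)) u} {u : TotalSpace F E}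
    (hb : V u = mlieBracket (𝓘(ℝ, B).prod 𝓘(ℝ, F)) (fun u => vlift u u.2) V u) (hu : u.2 = 0) :
    tcoord (V u) = 0 := by
  have h1 := fderiv_chartField_vertical hb
  have h2 : (trivializationAt F E u.proj u).2 = 0 := by
    have := (Trivialization.linear ℝ (trivializationAt F E u.proj)
      (mem_baseSet_trivializationAt F E u.proj)).map_zero
    rw [← hu] at this
    exact this
  rw [h2, ← Prod.zero_eq_mk, map_zero] at h1
  have h3 := congrArg Prod.fst h1
  have h4 := congrArg Prod.snd h1
  exact Prod.ext h3.symm ((smul_eq_zero.1 h4.symm).resolve_left two_ne_zero)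

/-- A vector field `V` with `[C, V] = V` is positively homogeneous. -/
theorem tcoord_scale [CompleteSpace B] [CompleteSpace F]
    {V : ∀ u : TotalSpace F E, TangentSpace (𝓘(ℝ, B).prod 𝓘(ℝ, F)) u}
    (hV : ContMDiff (𝓘(ℝ, B).prod 𝓘(ℝ, F)) (𝓘(ℝ, B).prod 𝓘(ℝ, F)).tangent 1
      (fun u => (⟨u, V u⟩ : TangentBundle (𝓘(ℝ, B).prod 𝓘(ℝ, F)) (TotalSpace F E))))
    (hb : ∀ u, V u = mlieBracket (𝓘(ℝ, B).prod 𝓘(ℝ, F)) (fun u => vlift u u.2) V u)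
    (u : TotalSpace F E) {r : ℝ} (hr : 0 < r) :
    tcoord (V (scale r u)) = (r • (tcoord (V u)).1, r ^ 2 • (tcoord (V u)).2) := by
  set x₀ := extChartAt 𝓘(ℝ, B) u.proj u.proj
  set y₀ := (trivializationAt F E u.proj u).2 with hy₀
  have hbase := mem_baseSet_trivializationAt F E u.proj
  have hκ : ∀ s : ℝ, extChartAt (𝓘(ℝ, B).prod 𝓘(ℝ, F)) u (scale s u) = (x₀, s • y₀) :=
    fun s => extChartAt_scale hbase s
  have hc : ∀ s : ℝ, tcoord (V (scale s u)) = chartField V u (x₀, s • y₀) := fun s => by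
    rw [← hκ s, chartField_extChartAt V (show u.proj = (scale s u).proj from rfl)]
  have hd : ∀ s : ℝ, HasDerivAt (fun s : ℝ => tcoord (V (scale s u)))
      (fderiv ℝ (chartField V u) (x₀, s • y₀) (0, y₀)) s := by
    intro s
    rw [funext hc]
    have h1 : DifferentiableAt ℝ (chartField V u) (x₀, s • y₀) := by
      have := contDiffAt_chartField (n := 1) (hV (scale s u))
      rw [extChartAt_eq_of_proj (show (scale s u).proj = u.proj from rfl), hκ s,
        chartField_eq_of_proj V (show (scale s u).proj = u.proj from rfl)] at this
      exact this.differentiableAt (by simp)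
    have h2 : HasDerivAt (fun s : ℝ => (x₀, s • y₀)) ((0, y₀) : B × F) s := by
      simpa using (hasDerivAt_const s x₀).prodMk ((hasDerivAt_id s).smul_const y₀)
    exact h1.hasFDerivAt.comp_hasDerivAt s h2
  -- Euler's relation at `scale s u` differentiates along `(0, s y₀)`, that is `s` times the
  -- velocity of the ray.
  have he : ∀ s : ℝ, s • fderiv ℝ (chartField V u) (x₀, s • y₀) (0, y₀) =
      ((tcoord (V (scale s u))).1, (2 : ℝ) • (tcoord (V (scale s u))).2) := by
    intro s
    have := fderiv_chartField_vertical (hb (scale s u))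
    rw [extChartAt_eq_of_proj (show (scale s u).proj = u.proj from rfl), hκ s,
      chartField_eq_of_proj V (show (scale s u).proj = u.proj from rfl)] at this
    rw [← this, ← map_smul]
    congr 1
    ext
    · simp
    · exact (trivialization_scale (trivializationAt F E u.proj) hbase s).symm
  have h1 : scale 1 u = u := by
    simp [scale]
  have e1 := eq_pow_smul_of_euler 1 (fun s _ => (hd s).fst)
    (fun s _ => by simpa using congrArg Prod.fst (he s)) hr
  have e2 := eq_pow_smul_of_euler 2 (fun s _ => (hd s).snd)
    (fun s _ => by simpa using congrArg Prod.snd (he s)) hr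
  rw [h1] at e1 e2
  rw [pow_one] at e1
  exact Prod.ext e1 e2

end Homogeneity

/-! ### Velocities of rescaled and reparametrized curves -/

section Curves

variable {B : Type*} [NormedAddCommGroup B] [NormedSpace ℝ B]
  {F : Type*} [NormedAddCommGroup F] [NormedSpace ℝ F]
  {M : Type*} [TopologicalSpace M] [ChartedSpace B M]
  {E : M → Type*} [∀ x, AddCommGroup (E x)] [∀ x, Module ℝ (E x)] [∀ x, TopologicalSpace (E x)]
  [TopologicalSpace (TotalSpace F E)] [FiberBundle F E] [VectorBundle ℝ F E]

theorem trivialization_eq_zero_iff (e : Trivialization F (π F E)) [MemTrivializationAtlas e]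
    {u : TotalSpace F E} (hu : u.proj ∈ e.baseSet) : (e u).2 = 0 ↔ u.2 = 0 := by
  have h := (e.continuousLinearEquivAt ℝ u.proj hu).map_eq_zero_iff (x := u.2)
  rw [← h]
  rfl

theorem fcoord_eq_zero_iff {u : TotalSpace F E} : fcoord u = 0 ↔ u.2 = 0 :=
  trivialization_eq_zero_iff _ (mem_baseSet_trivializationAt F E u.proj)

theorem isOpen_ne_zero : IsOpen {u : TotalSpace F E | u.2 ≠ 0} := by
  rw [isOpen_iff_mem_nhds]
  intro u hu
  set e := trivializationAt F E u.proj
  have hb : u.proj ∈ e.baseSet := mem_baseSet_trivializationAt F E u.proj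
  have hs : e.source ∈ 𝓝 u := e.open_source.mem_nhds (e.mem_source.2 hb)
  have hc : ContinuousAt (fun v => (e v).2) u :=
    continuous_snd.continuousAt.comp (e.continuousOn.continuousAt hs)
  filter_upwards [hs, hc.eventually_ne (mt (trivialization_eq_zero_iff e hb).1 hu)] with v hv hv'
  exact mt (trivialization_eq_zero_iff e (e.mem_source.1 hv)).2 hv'

variable {l : ℝ → TotalSpace F E} {φ p : ℝ → ℝ} {s φ' : ℝ}
  {v : TangentSpace (𝓘(ℝ, B).prod 𝓘(ℝ, F)) (l (φ s))}

theorem eventually_extChartAt_scale (hl : ContinuousAt l (φ s)) (hφ : ContinuousAt φ s) :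
    ∀ᶠ r in 𝓝 s, scale (p r) (l (φ r)) ∈ (extChartAt (𝓘(ℝ, B).prod 𝓘(ℝ, F)) (l (φ s))).source ∧
      extChartAt (𝓘(ℝ, B).prod 𝓘(ℝ, F)) (l (φ s)) (scale (p r) (l (φ r))) =
      ((extChartAt (𝓘(ℝ, B).prod 𝓘(ℝ, F)) (l (φ s)) (l (φ r))).1,
        p r • (extChartAt (𝓘(ℝ, B).prod 𝓘(ℝ, F)) (l (φ s)) (l (φ r))).2) := by
  have hc : ContinuousAt (fun r => l (φ r)) s := ContinuousAt.comp (f := φ) hl hφ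
  filter_upwards [hc (extChartAt_source_mem_nhds (I := 𝓘(ℝ, B).prod 𝓘(ℝ, F)) (l (φ s)))]
    with r hr
  have hr' := mem_extChartAt_source_iff.1 hr
  refine ⟨mem_extChartAt_source_iff.2 hr', ?_⟩
  rw [extChartAt_scale hr'.1]
  have := extChartAt_mk (B := B) (l (φ s)) hr'.1 (l (φ r)).2
  exact congrArg (fun q : B × F => (q.1, p r • q.2)) this.symm

/-- The velocity of a rescaled and reparametrized curve. -/
theorem hasMFDerivAt_scale_comp {q : ℝ} (hφ : HasDerivAt φ φ' s) (hp : HasDerivAt p q s)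
    (hl : HasMFDerivAt 𝓘(ℝ, ℝ) (𝓘(ℝ, B).prod 𝓘(ℝ, F)) l (φ s) ((1 : ℝ →L[ℝ] ℝ).smulRight v))
    {w : TangentSpace (𝓘(ℝ, B).prod 𝓘(ℝ, F)) (scale (p s) (l (φ s)))}
    (hw : tcoord w =
      (φ' • (tcoord v).1, q • fcoord (l (φ s)) + (p s * φ') • (tcoord v).2)) :
    HasMFDerivAt 𝓘(ℝ, ℝ) (𝓘(ℝ, B).prod 𝓘(ℝ, F)) (fun s => scale (p s) (l (φ s))) s
      ((1 : ℝ →L[ℝ] ℝ).smulRight w) := by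
  obtain ⟨hlc, hld⟩ := hasMFDerivAt_curve_iff.1 hl
  have hc : HasDerivAt (fun r => extChartAt (𝓘(ℝ, B).prod 𝓘(ℝ, F)) (l (φ s)) (l (φ r)))
      (φ' • tcoord v) s := hld.scomp s hφ
  have hev := eventually_extChartAt_scale (B := B) (p := p) hlc hφ.continuousAt
  have hd : HasDerivAt (fun r => extChartAt (𝓘(ℝ, B).prod 𝓘(ℝ, F)) (l (φ s))
      (scale (p r) (l (φ r)))) (tcoord w) s := by
    have h1 : HasDerivAt (fun r => ((extChartAt (𝓘(ℝ, B).prod 𝓘(ℝ, F)) (l (φ s)) (l (φ r))).1,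
        p r • (extChartAt (𝓘(ℝ, B).prod 𝓘(ℝ, F)) (l (φ s)) (l (φ r))).2)) _ s :=
      HasDerivAt.prodMk hc.fst (HasDerivAt.fun_smul hp hc.snd)
    refine (h1.congr_deriv ?_).congr_of_eventuallyEq (hev.mono fun r hr => hr.2)
    rw [hw, extChartAt_self_snd, Prod.smul_fst, Prod.smul_snd, smul_smul, add_comm]
  refine hasMFDerivAt_curve_iff.2 ⟨?_, ?_⟩
  · have h0 : extChartAt (𝓘(ℝ, B).prod 𝓘(ℝ, F)) (l (φ s)) (scale (p s) (l (φ s))) ∈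
        (extChartAt (𝓘(ℝ, B).prod 𝓘(ℝ, F)) (l (φ s))).target :=
      (extChartAt _ _).map_source hev.self_of_nhds.1
    have h2 := (continuousAt_extChartAt_symm'' h0).comp
      (f := fun r => extChartAt (𝓘(ℝ, B).prod 𝓘(ℝ, F)) (l (φ s)) (scale (p r) (l (φ r))))
      (x := s) hd.continuousAt
    refine h2.congr (hev.mono fun r hr => ?_)
    exact (extChartAt _ _).left_inv hr.1
  · rw [extChartAt_eq_of_proj (B := B) (b := scale (p s) (l (φ s))) (u := l (φ s)) rfl]
    exact hd

/-- If a rescaled and reparametrized curve is differentiable off the zero section, then so is the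
factor. -/
theorem exists_tcoord_of_hasMFDerivAt_scale_comp (hφ : HasDerivAt φ φ' s)
    (hl : HasMFDerivAt 𝓘(ℝ, ℝ) (𝓘(ℝ, B).prod 𝓘(ℝ, F)) l (φ s) ((1 : ℝ →L[ℝ] ℝ).smulRight v))
    (h0 : (l (φ s)).2 ≠ 0)
    {w : TangentSpace (𝓘(ℝ, B).prod 𝓘(ℝ, F)) (scale (p s) (l (φ s)))}
    (hw : HasMFDerivAt 𝓘(ℝ, ℝ) (𝓘(ℝ, B).prod 𝓘(ℝ, F)) (fun s => scale (p s) (l (φ s))) s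
      ((1 : ℝ →L[ℝ] ℝ).smulRight w)) :
    ∃ q : ℝ, (tcoord w).2 = q • fcoord (l (φ s)) + (p s * φ') • (tcoord v).2 := by
  obtain ⟨hlc, hld⟩ := hasMFDerivAt_curve_iff.1 hl
  have hc : HasDerivAt (fun r => extChartAt (𝓘(ℝ, B).prod 𝓘(ℝ, F)) (l (φ s)) (l (φ r)))
      (φ' • tcoord v) s := hld.scomp s hφ
  have hev := eventually_extChartAt_scale (B := B) (p := p) hlc hφ.continuousAt
  have hd := (hasMFDerivAt_curve_iff.1 hw).2
  rw [extChartAt_eq_of_proj (B := B) (b := scale (p s) (l (φ s))) (u := l (φ s)) rfl] at hd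
  have hds : HasDerivAt (fun r => (extChartAt (𝓘(ℝ, B).prod 𝓘(ℝ, F)) (l (φ s))
      (scale (p r) (l (φ r)))).2) (tcoord w).2 s := hd.snd
  have hd2 : HasDerivAt (fun r => p r •
      (extChartAt (𝓘(ℝ, B).prod 𝓘(ℝ, F)) (l (φ s)) (l (φ r))).2) (tcoord w).2 s :=
    HasDerivAt.congr_of_eventuallyEq hds (hev.mono fun r hr => (congrArg Prod.snd hr.2).symm)
  -- The factor `p` (later `φ'`) is not known to be differentiable. It is the quotient of `L (p y)`
  -- by `L y`, both differentiable at `s`.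
  obtain ⟨L, hL⟩ := SeparatingDual.exists_ne_zero (R := ℝ) (mt fcoord_eq_zero_iff.1 h0)
  have hL' : L (extChartAt (𝓘(ℝ, B).prod 𝓘(ℝ, F)) (l (φ s)) (l (φ s))).2 ≠ 0 := by
    rwa [extChartAt_self_snd]
  have hLy := L.hasFDerivAt.comp_hasDerivAt s hc.snd
  have hp : DifferentiableAt ℝ p s := by
    have h1 := ((L.hasFDerivAt.comp_hasDerivAt s hd2).fun_div hLy hL').differentiableAt
    refine h1.congr_of_eventuallyEq ?_
    filter_upwards [hLy.continuousAt.eventually_ne hL'] with r hr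
    have hr' : L (extChartAt (𝓘(ℝ, B).prod 𝓘(ℝ, F)) (l (φ s)) (l (φ r))).2 ≠ 0 := hr
    simp only [Function.comp_apply, map_smul, smul_eq_mul]
    rw [mul_div_cancel_right₀ _ hr']
  refine ⟨deriv p s, ?_⟩
  have := hd2.unique (hp.hasDerivAt.fun_smul hc.snd)
  rw [this, extChartAt_self_snd, Prod.smul_snd, smul_smul, add_comm]

end Curves

/-! ### Sprays, their geodesics, and reparametrization -/

section Sprays

variable {B : Type*} [NormedAddCommGroup B] [NormedSpace ℝ B]
  {F : Type*} [NormedAddCommGroup F] [NormedSpace ℝ F]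
  {M : Type*} [TopologicalSpace M] [ChartedSpace B M] [IsManifold 𝓘(ℝ, B) ∞ M]
  {E : M → Type*} [∀ x, AddCommGroup (E x)] [∀ x, Module ℝ (E x)] [∀ x, TopologicalSpace (E x)]
  [TopologicalSpace (TotalSpace F E)] [FiberBundle F E] [VectorBundle ℝ F E]
  [ContMDiffVectorBundle ∞ F E 𝓘(ℝ, B)]
  {A : GenLieAlgebroid B F M E} {g : LocInvMorphism A} {D : Set (TotalSpace F E)}
  {𝔐 : MechanicalSystem A D} {S : PSection A}

namespace IsSprayOf

/-- `J S = ℂ` equates the vertical lifts of `g⁻¹ (S.fst u)` and `u`, and vertical lifting is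
injective. Two sprays thus have the same projection to `TM`. -/
theorem fst_eq (hS : IsSprayOf 𝔐 g S) (u : TotalSpace F E) : S.fst u = g.g u.proj u.2 := by
  have h1 : vlift (B := B) u ((g.g u.proj).symm (S.fst u)) = vlift u u.2 :=
    congrArg (fun Z : PSection A => Z.snd u) hS.semispray
  have h2 := congrArg (fun v => (tcoord v).2) h1
  simp only [tcoord_vlift] at h2
  have hb := mem_baseSet_trivializationAt F E u.proj
  have h3 : (g.g u.proj).symm (S.fst u) = u.2 :=
    ((trivializationAt F E u.proj).continuousLinearEquivAt ℝ u.proj hb).injective h2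
  rw [← h3, LinearEquiv.apply_symm_apply]

theorem contMDiff_snd (hS : IsSprayOf 𝔐 g S) :
    ContMDiff (𝓘(ℝ, B).prod 𝓘(ℝ, F)) (𝓘(ℝ, B).prod 𝓘(ℝ, F)).tangent 1
      (fun u => (⟨u, S.snd u⟩ : TangentBundle (𝓘(ℝ, B).prod 𝓘(ℝ, F)) (TotalSpace F E))) :=
  contMDiffOn_univ.1 hS.regular_zero.2

theorem mfderiv_proj_snd (hS : IsSprayOf 𝔐 g S) (u : TotalSpace F E) :
    mfderiv (𝓘(ℝ, B).prod 𝓘(ℝ, F)) 𝓘(ℝ, B) (π F E) u (S.snd u) =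
      anchorAt A u.proj (g.g u.proj u.2) := by
  rw [← hS.fst_eq u]
  exact (S u).2

theorem bracket_snd (hS : IsSprayOf 𝔐 g S) (u : TotalSpace F E) :
    S.snd u = mlieBracket (𝓘(ℝ, B).prod 𝓘(ℝ, F)) (fun u => vlift u u.2) S.snd u :=
  (hS.derivation u (mem_univ u)).1

/-- For a semispray, a geodesic is an integral curve lying over its base curve. -/
theorem isGeodesic (hS : IsSprayOf 𝔐 g S) {I : Set ℝ} (hI : IsOpen I) (hI' : I.OrdConnected)
    {c : ℝ → M} {l : ℝ → TotalSpace F E} (hl : IsMIntegralCurveOn l S.snd I)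
    (hc : ∀ t ∈ I, (l t).proj = A.η (A.h (c t))) : IsGeodesic g S I c l := by
  have hd : ∀ t ∈ I, HasMFDerivAt 𝓘(ℝ, ℝ) (𝓘(ℝ, B).prod 𝓘(ℝ, F)) l t
      ((1 : ℝ →L[ℝ] ℝ).smulRight (S.snd (l t))) := fun t ht =>
    (hl t ht).hasMFDerivAt (hI.mem_nhds ht)
  refine ⟨hI, hI', ⟨fun t ht => ?_, fun t ht => (hd t ht).mdifferentiableAt, hc, fun t ht => ?_⟩,
    hl⟩
  · have h1 : MDifferentiableAt 𝓘(ℝ, ℝ) 𝓘(ℝ, B) (fun s => (l s).proj) t :=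
      MDifferentiableAt.comp t (mdifferentiableAt_proj E) (hd t ht).mdifferentiableAt
    have h2 : MDifferentiableAt 𝓘(ℝ, ℝ) 𝓘(ℝ, B) (fun s => A.h.symm (A.η.symm (l s).proj)) t :=
      MDifferentiableAt.comp t (A.h.symm.mdifferentiable (by simp) _)
        (MDifferentiableAt.comp t (A.η.symm.mdifferentiable (by simp) _) h1)
    refine h2.congr_of_eventuallyEq ?_
    filter_upwards [hI.mem_nhds ht] with s hs
    rw [hc s hs, Diffeomorph.symm_apply_apply, Diffeomorph.symm_apply_apply]
  · have h1 := (hS.mfderiv_proj_snd (l t))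
    have h2 : HasMFDerivAt 𝓘(ℝ, ℝ) 𝓘(ℝ, B) (π F E ∘ l) t
        ((mfderiv (𝓘(ℝ, B).prod 𝓘(ℝ, F)) 𝓘(ℝ, B) (π F E) (l t)).comp
          ((1 : ℝ →L[ℝ] ℝ).smulRight (S.snd (l t)))) :=
      HasMFDerivAt.comp t (mdifferentiableAt_proj E).hasMFDerivAt (hd t ht)
    have h3 : (fun s => A.η (A.h (c s))) =ᶠ[𝓝 t] π F E ∘ l := by
      filter_upwards [hI.mem_nhds ht] with s hs using (hc s hs).symm
    have h4 := (h2.congr_of_eventuallyEq h3).mfderiv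
    have mk_eq : ∀ {x y : M} (v w : B), x = y → v = w →
        (⟨x, v⟩ : TangentBundle 𝓘(ℝ, B) M) = ⟨y, w⟩ := by
      rintro x _ v _ rfl rfl
      rfl
    refine mk_eq _ _ (hc t ht) ?_
    rw [h4, ← h1]
    exact (congrArg _ (one_smul ℝ _)).symm

theorem snd_eq_zero [CompleteSpace B] [CompleteSpace F] (hS : IsSprayOf 𝔐 g S)
    {u : TotalSpace F E} (hu : u.2 = 0) : S.snd u = 0 :=
  tcoord_eq_zero_of_bracket (hS.bracket_snd u) hu

theorem tcoord_snd_scale [CompleteSpace B] [CompleteSpace F] (hS : IsSprayOf 𝔐 g S)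
    (u : TotalSpace F E) {r : ℝ} (hr : 0 < r) :
    tcoord (S.snd (scale r u)) = (r • (tcoord (S.snd u)).1, r ^ 2 • (tcoord (S.snd u)).2) :=
  tcoord_scale hS.contMDiff_snd hS.bracket_snd u hr

/-- Integral curves of a spray starting in the zero section stay there. -/
theorem eqOn_zero [CompleteSpace B] [CompleteSpace F] (hS : IsSprayOf 𝔐 g S) {I : Set ℝ}
    (hI : IsOpen I) (hI' : I.OrdConnected) {l : ℝ → TotalSpace F E}
    (hl : IsMIntegralCurveOn l S.snd I) {t₀ : ℝ} (ht₀ : t₀ ∈ I) (h0 : (l t₀).2 = 0) :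
    ∀ t ∈ I, (l t).2 = 0 := by
  set Z : Set ℝ := {t | t ∈ I ∧ (l t).2 = 0}
  suffices I ⊆ Z from fun t ht => (this ht).2
  refine hI'.isPreconnected.subset_of_closure_inter_subset ?_ ⟨t₀, ht₀, ht₀, h0⟩ ?_
  · rw [isOpen_iff_mem_nhds]
    rintro t ⟨ht, htz⟩
    -- `S` vanishes at `l t`, so the constant curve is a competitor; uniqueness applies because `S`
    -- is `C^1` on the zero section as well.
    have h1 : IsMIntegralCurveAt (fun _ : ℝ => l t) S.snd t := by
      refine Eventually.of_forall fun s => ?_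
      have h2 : (1 : ℝ →L[ℝ] ℝ).smulRight (S.snd (l t)) = 0 := by
        rw [hS.snd_eq_zero htz]
        ext
        simp
      rw [h2]
      exact hasMFDerivAt_const _ _
    have h2 := isMIntegralCurveAt_eventuallyEq_of_contMDiffAt_boundaryless
      (hS.contMDiff_snd (l t)) (hl.isMIntegralCurveAt (hI.mem_nhds ht)) h1 rfl
    filter_upwards [h2, hI.mem_nhds ht] with s hs hsI
    exact ⟨hsI, by rw [hs]; exact htz⟩
  · rintro t ⟨htc, ht⟩
    refine ⟨ht, ?_⟩
    by_contra hne
    have hc : ContinuousAt l t := ((hl t ht).hasMFDerivAt (hI.mem_nhds ht)).continuousAt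
    have h1 : ∀ᶠ s in 𝓝 t, (l s).2 ≠ 0 := hc (isOpen_ne_zero.mem_nhds hne)
    obtain ⟨s, hs, hsZ⟩ := (mem_closure_iff_frequently.1 htc).and_eventually h1 |>.exists
    exact hsZ hs.2

end IsSprayOf

variable {𝔐' : MechanicalSystem A D} {S' : PSection A}

/-- A projective change only reparametrizes geodesics. -/
theorem geodesicsReparamInto_of_snd_eq [CompleteSpace B] [CompleteSpace F]
    (hS : IsSprayOf 𝔐 g S) (hS' : IsSprayOf 𝔐' g S') (hD : {u : TotalSpace F E | u.2 ≠ 0} ⊆ D)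
    {f : TotalSpace F E → ℝ} (hf : ContinuousOn f D)
    (h : ∀ u, S'.snd u = S.snd u + f u • vlift u u.2) : GeodesicsReparamInto g S S' := by
  intro I c l hgeo
  have hd : ∀ t ∈ I, HasMFDerivAt 𝓘(ℝ, ℝ) (𝓘(ℝ, B).prod 𝓘(ℝ, F)) l t
      ((1 : ℝ →L[ℝ] ℝ).smulRight (S.snd (l t))) := fun t ht =>
    (hgeo.integral t ht).hasMFDerivAt (hgeo.isOpen.mem_nhds ht)
  by_cases hz : ∃ t ∈ I, (l t).2 = 0
  · obtain ⟨t₀, ht₀, h0⟩ := hz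
    have hall := hS.eqOn_zero hgeo.isOpen hgeo.interval hgeo.integral ht₀ h0
    -- Both sprays vanish along such a geodesic, so the identity transformation will do.
    refine ⟨I, id, ⟨differentiableOn_id, fun s _ => by simp, strictMonoOn_id, image_id _⟩, ?_⟩
    have hl : (fun s => TotalSpace.mk' F (l (id s)).proj (deriv id s • (l (id s)).2)) = l := by
      funext s
      simp
    rw [hl]
    refine hS'.isGeodesic hgeo.isOpen hgeo.interval (fun t ht => ?_) hgeo.lift.lies_over
    rw [hS'.snd_eq_zero (hall t ht), ← hS.snd_eq_zero (hall t ht)]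
    exact hgeo.integral t ht
  · push Not at hz
    have hk : ContinuousOn (fun t => f (l t)) I :=
      hf.comp (fun t ht => (hd t ht).continuousAt.continuousWithinAt) fun t ht => hD (hz t ht)
    obtain ⟨J, φ, hJ, hJ', hφ, hφ'⟩ := exists_reparam hgeo.isOpen hgeo.interval hk
    have hmaps : ∀ s ∈ J, φ s ∈ I := fun s hs => hφ.onto ▸ mem_image_of_mem φ hs
    refine ⟨J, φ, hφ, hS'.isGeodesic hJ hJ' (fun s hs => HasMFDerivAt.hasMFDerivWithinAt ?_)
      fun s hs => hgeo.lift.lies_over _ (hmaps s hs)⟩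
    refine hasMFDerivAt_scale_comp
      ((hφ.diff s hs).differentiableAt (hJ.mem_nhds hs)).hasDerivAt (hφ' s hs)
      (hd _ (hmaps s hs)) ?_
    have h1 : tcoord (S'.snd (l (φ s))) = tcoord (S.snd (l (φ s))) +
        f (l (φ s)) • ((0, fcoord (l (φ s))) : B × F) := by
      rw [h]
      exact congrArg (fun q => tcoord (S.snd (l (φ s))) + f (l (φ s)) • q) (tcoord_vlift _ _)
    refine (hS'.tcoord_snd_scale (l (φ s)) (hφ.pos s hs)).trans ?_
    rw [h1]
    ext
    · simp
    · simp only [Prod.snd_add, Prod.smul_snd, smul_add, smul_smul, sq]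
      rw [add_comm]

/-- If geodesics are reparametrized into geodesics, the sprays differ by a multiple of the Liouville
section. -/
theorem exists_tcoord_eq_of_geodesicsReparamInto [CompleteSpace B] [CompleteSpace F]
    (hS : IsSprayOf 𝔐 g S) (hS' : IsSprayOf 𝔐' g S') (h : GeodesicsReparamInto g S S')
    {u : TotalSpace F E} (hu : u.2 ≠ 0) :
    ∃ r : ℝ, tcoord (S'.snd u) = tcoord (S.snd u) + r • ((0, fcoord u) : B × F) := by
  obtain ⟨l, hl0, hl⟩ := exists_isMIntegralCurveAt_of_contMDiffAt_boundaryless 0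
    (hS.contMDiff_snd u)
  obtain ⟨ε, hε, hl⟩ := isMIntegralCurveAt_iff'.1 hl
  have h0 : (0 : ℝ) ∈ Metric.ball (0 : ℝ) ε := Metric.mem_ball_self hε
  -- Any integral curve is a geodesic: its base curve is found by inverting `η ∘ h`.
  have hgeo := hS.isGeodesic (c := fun t => A.h.symm (A.η.symm (l t).proj)) Metric.isOpen_ball
    ((convex_ball (0 : ℝ) ε).ordConnected) hl (fun t _ => by simp)
  obtain ⟨J, φ, hφ, hgeo'⟩ := h _ _ _ hgeo
  obtain ⟨s, hs, hs0⟩ : (0 : ℝ) ∈ φ '' J := hφ.onto ▸ h0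
  have hlu : l (φ s) = u := by rw [hs0, hl0]
  have hds : HasDerivAt φ (deriv φ s) s :=
    ((hφ.diff s hs).differentiableAt (hgeo'.isOpen.mem_nhds hs)).hasDerivAt
  have hd : HasMFDerivAt 𝓘(ℝ, ℝ) (𝓘(ℝ, B).prod 𝓘(ℝ, F)) l (φ s)
      ((1 : ℝ →L[ℝ] ℝ).smulRight (S.snd (l (φ s)))) :=
    (hl _ (hs0 ▸ h0)).hasMFDerivAt (Metric.isOpen_ball.mem_nhds (hs0 ▸ h0))
  have hd' := (hgeo'.integral s hs).hasMFDerivAt (hgeo'.isOpen.mem_nhds hs)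
  obtain ⟨q, hq⟩ := exists_tcoord_of_hasMFDerivAt_scale_comp (p := deriv φ) hds hd
    (by rwa [hlu]) hd'
  have hpos := hφ.pos s hs
  have h1 := congrArg Prod.snd (hS'.tcoord_snd_scale (l (φ s)) hpos)
  have h2 := h1.symm.trans hq
  rw [hlu] at h2
  have hfst : (tcoord (S'.snd u)).1 = (tcoord (S.snd u)).1 := by
    rw [← mfderiv_proj_apply, ← mfderiv_proj_apply, hS.mfderiv_proj_snd, hS'.mfderiv_proj_snd]
  -- The vertical components give `φ'² S' = q y + φ'² S` at `u`.
  refine ⟨q / deriv φ s ^ 2, Prod.ext ?_ ?_⟩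
  · simp [hfst]
  · have hne : deriv φ s ^ 2 ≠ 0 := pow_ne_zero 2 hpos.ne'
    refine smul_right_injective F hne ?_
    simp only [Prod.snd_add, Prod.smul_snd, smul_add, smul_smul]
    rw [mul_div_cancel₀ _ hne, add_comm]
    rw [← sq] at h2
    exact h2

end Sprays

/-! ### Regularity and homogeneity of the projective factor -/

section Projective

variable {B : Type*} [NormedAddCommGroup B] [NormedSpace ℝ B]
  {F : Type*} [NormedAddCommGroup F] [NormedSpace ℝ F]
  {M : Type*} [TopologicalSpace M] [ChartedSpace B M] [IsManifold 𝓘(ℝ, B) ∞ M]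
  {E : M → Type*} [∀ x, AddCommGroup (E x)] [∀ x, Module ℝ (E x)] [∀ x, TopologicalSpace (E x)]
  [TopologicalSpace (TotalSpace F E)] [FiberBundle F E] [VectorBundle ℝ F E]
  [ContMDiffVectorBundle ∞ F E 𝓘(ℝ, B)]

/-- The factor of a projective change of homogeneous vector fields is of class `C^1`. -/
theorem contMDiffAt_of_eq_add_smul_vlift [CompleteSpace B] [FiniteDimensional ℝ F]
    {V V' : ∀ u : TotalSpace F E, TangentSpace (𝓘(ℝ, B).prod 𝓘(ℝ, F)) u}
    {f : TotalSpace F E → ℝ} (h : ∀ u, V' u = V u + f u • vlift u u.2)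
    (hf : ∀ u, ∀ r : ℝ, 0 < r → f (scale r u) = r * f u) {u : TotalSpace F E}
    (hV : ContMDiffAt (𝓘(ℝ, B).prod 𝓘(ℝ, F)) (𝓘(ℝ, B).prod 𝓘(ℝ, F)).tangent 2
      (fun u => (⟨u, V u⟩ : TangentBundle (𝓘(ℝ, B).prod 𝓘(ℝ, F)) (TotalSpace F E))) u)
    (hV' : ContMDiffAt (𝓘(ℝ, B).prod 𝓘(ℝ, F)) (𝓘(ℝ, B).prod 𝓘(ℝ, F)).tangent 2
      (fun u => (⟨u, V' u⟩ : TangentBundle (𝓘(ℝ, B).prod 𝓘(ℝ, F)) (TotalSpace F E))) u) :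
    ContMDiffAt (𝓘(ℝ, B).prod 𝓘(ℝ, F)) 𝓘(ℝ, ℝ) 1 f u := by
  have : CompleteSpace F := FiniteDimensional.complete ℝ F
  set κ := extChartAt (𝓘(ℝ, B).prod 𝓘(ℝ, F)) u with hκ
  set U : Set B := (extChartAt 𝓘(ℝ, B) u.proj).target ∩
    (extChartAt 𝓘(ℝ, B) u.proj).symm ⁻¹' (trivializationAt F E u.proj).baseSet
  have htarget : κ.target = U ×ˢ univ := FiberBundle.extChartAt_target u
  have hmem : ∀ {z : B × F}, z ∈ κ.target ↔ z.1 ∈ U := by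
    intro z
    rw [htarget]
    simp
  have hU : IsOpen U := by
    have h1 : U = (fun x : B => (x, (0 : F))) ⁻¹' κ.target := by
      ext x
      exact (hmem (z := (x, 0))).symm
    rw [h1]
    exact (isOpen_extChartAt_target u).preimage (by fun_prop)
  have hscale : ∀ z : B × F, z.1 ∈ U → ∀ r : ℝ,
      κ.symm (z.1, r • z.2) = scale r (κ.symm z) := by
    intro z hz r
    have hs := κ.map_target (hmem.2 hz)
    have hs' := mem_extChartAt_source_iff.1 hs
    have hsr : scale r (κ.symm z) ∈ κ.source := mem_extChartAt_source_iff.2 hs'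
    have h1 := extChartAt_mk (B := B) u hs'.1 (κ.symm z).2
    have h2 : z = _ := (κ.right_inv (hmem.2 hz)).symm.trans h1
    have h3 : κ (scale r (κ.symm z)) = (z.1, r • z.2) := by
      rw [hκ, extChartAt_scale hs'.1]
      conv_rhs => rw [h2]
    rw [← h3, κ.left_inv hsr]
  -- The difference of the chart fields has fibre part `f y`, the form of `Q` required by
  -- `contDiffAt_of_smul_snd`.
  have hfact : ∀ z : B × F, z.1 ∈ U →
      (chartField V' u z - chartField V u z).2 = f (κ.symm z) • z.2 := by
    intro z hz
    have hz' := hmem.2 hz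
    have h1 := chartField_vlift (B := B) u hz'
    rw [chartField_apply _ _ hz'] at h1
    rw [chartField_apply _ _ hz', chartField_apply _ _ hz', h, map_add, map_smul]
    have h2 : ∀ X Y : B × F, Y = (0, z.2) →
        ((X + f (κ.symm z) • Y) - X).2 = f (κ.symm z) • z.2 := by
      rintro X _ rfl
      simp
    exact h2 _ _ h1
  have hz0 : (κ u).1 ∈ U := hmem.1 (mem_extChartAt_target u)
  have hC : ContDiffAt ℝ 1 (fun z => f (κ.symm z)) (κ u) := by
    refine contDiffAt_of_smul_snd hU hfact (fun z hz r hr => ?_) hz0 ?_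
    · rw [hscale z hz, hf _ r hr]
    · exact ((contDiffAt_chartField (n := 2) hV').sub (contDiffAt_chartField (n := 2) hV)).snd
  have h1 : ContMDiffAt (𝓘(ℝ, B).prod 𝓘(ℝ, F)) 𝓘(ℝ, ℝ) 1 ((fun z => f (κ.symm z)) ∘ κ) u :=
    hC.contMDiffAt.comp u contMDiffAt_extChartAt
  refine h1.congr_of_eventuallyEq ?_
  filter_upwards [extChartAt_source_mem_nhds (I := 𝓘(ℝ, B).prod 𝓘(ℝ, F)) u] with v hv
  rw [Function.comp_apply, κ.left_inv hv]

variable {A : GenLieAlgebroid B F M E} {g : LocInvMorphism A} {D : Set (TotalSpace F E)}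
  {𝔐 𝔐' : MechanicalSystem A D} {S S' : PSection A}

/-- The factor between two sprays is positively `1`-homogeneous. -/
theorem factor_scale [CompleteSpace B] [CompleteSpace F] (hS : IsSprayOf 𝔐 g S)
    (hS' : IsSprayOf 𝔐' g S') {f : TotalSpace F E → ℝ} (h0 : ∀ u, u.2 = 0 → f u = 0)
    (h : ∀ u, tcoord (S'.snd u) = tcoord (S.snd u) + f u • ((0, fcoord u) : B × F))
    (u : TotalSpace F E) {r : ℝ} (hr : 0 < r) : f (scale r u) = r * f u := by
  by_cases hu : u.2 = 0
  · rw [h0 u hu, h0 (scale r u) ((congrArg (r • ·) hu).trans (smul_zero (A := E u.proj) r)), mul_zero]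
  have hy : fcoord u ≠ 0 := mt fcoord_eq_zero_iff.1 hu
  have h1 := h (scale r u)
  rw [hS.tcoord_snd_scale u hr, hS'.tcoord_snd_scale u hr, h u] at h1
  have h2 := congrArg Prod.snd h1
  have h3 : fcoord (scale r u) = r • fcoord u :=
    trivialization_scale _ (mem_baseSet_trivializationAt F E u.proj) r
  simp only [Prod.snd_add, Prod.smul_snd, smul_add, h3, smul_smul] at h2
  -- Degree 2 on the left against degree 1 of `y` on the right: `r² f u = f (r u) r`.
  have h4 := smul_left_injective ℝ hy (add_left_cancel h2)
  have h5 : r * (r * f u) = r * f (scale r u) := by linear_combination h4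
  exact (mul_left_cancel₀ hr.ne' h5).symm

theorem projectivelyRelated_of_geodesicsReparamInto [CompleteSpace B] [FiniteDimensional ℝ F]
    (hS : IsSprayOf 𝔐 g S) (hS' : IsSprayOf 𝔐' g S') (hD : IsOpen D)
    (h : GeodesicsReparamInto g S S') : ProjectivelyRelated D S S' := by
  have : CompleteSpace F := FiniteDimensional.complete ℝ F
  -- On the zero section every multiple of `ℂ` vanishes; the value 0 is imposed there to make `f`
  -- homogeneous.
  have hex : ∀ u : TotalSpace F E, ∃ r : ℝ, (u.2 = 0 → r = 0) ∧
      tcoord (S'.snd u) = tcoord (S.snd u) + r • ((0, fcoord u) : B × F) := by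
    intro u
    by_cases hu : u.2 = 0
    · refine ⟨0, fun _ => rfl, ?_⟩
      rw [hS.snd_eq_zero hu, hS'.snd_eq_zero hu, zero_smul, add_zero]
    · obtain ⟨r, hr⟩ := exists_tcoord_eq_of_geodesicsReparamInto hS hS' h hu
      exact ⟨r, fun h => absurd h hu, hr⟩
  choose f hf0 hf using hex
  have hscale : ∀ u, ∀ r : ℝ, 0 < r → f (scale r u) = r * f u := fun u r hr =>
    factor_scale hS hS' hf0 hf u hr
  have hsnd : ∀ u, S'.snd u = S.snd u + f u • vlift u u.2 := by
    intro u
    refine (hf u).trans ?_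
    exact congrArg (fun q => tcoord (S.snd u) + f u • q) (tcoord_vlift u u.2).symm
  have hC : ∀ u ∈ D, ContMDiffAt (𝓘(ℝ, B).prod 𝓘(ℝ, F)) 𝓘(ℝ, ℝ) 1 f u := fun u hu =>
    contMDiffAt_of_eq_add_smul_vlift hsnd hscale
      (((hS.smooth.2 u hu).contMDiffAt (hD.mem_nhds hu)).of_le (WithTop.coe_le_coe.2 (le_top (a := (2 : ℕ∞)))))
      (((hS'.smooth.2 u hu).contMDiffAt (hD.mem_nhds hu)).of_le (WithTop.coe_le_coe.2 (le_top (a := (2 : ℕ∞)))))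
  refine ⟨f, fun u hu => (hC u hu).contMDiffWithinAt, fun u hu => ?_, fun u => ?_⟩
  · exact dirDeriv_vlift_self ((hC u hu).mdifferentiableAt (by simp)) (hscale u)
  · refine Subtype.ext (Prod.ext ?_ (hsnd u))
    have h1 : S'.fst u = S.fst u := (hS'.fst_eq u).trans (hS.fst_eq u).symm
    change S'.fst u = S.fst u + f u • (0 : E (A.h u.proj))
    rw [smul_zero, add_zero, h1]

/-- Exchanging the sprays replaces `f` by `-f`, so one direction yields both. -/
theorem geodesicsReparamInto_of_projectivelyRelated [CompleteSpace B] [CompleteSpace F]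
    (hS : IsSprayOf 𝔐 g S) (hS' : IsSprayOf 𝔐' g S') (hD : {u : TotalSpace F E | u.2 ≠ 0} ⊆ D)
    (h : ProjectivelyRelated D S S') :
    GeodesicsReparamInto g S S' ∧ GeodesicsReparamInto g S' S := by
  obtain ⟨f, hf, -, hfS⟩ := h
  have hsnd : ∀ u, S'.snd u = S.snd u + f u • vlift u u.2 := fun u =>
    congrArg (fun Z : Prolong A u => Z.1.2) (hfS u)
  refine ⟨geodesicsReparamInto_of_snd_eq hS hS' hD hf.continuousOn hsnd,
    geodesicsReparamInto_of_snd_eq (f := fun u => -f u) hS' hS hD hf.continuousOn.neg fun u => ?_⟩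
  rw [hsnd u, neg_smul, add_neg_cancel_right]

end Projective

end GenLieAlg

theorem mainTheorem1
    {B : Type*} [NormedAddCommGroup B] [NormedSpace ℝ B] [FiniteDimensional ℝ B]
    {F : Type*} [NormedAddCommGroup F] [NormedSpace ℝ F] [FiniteDimensional ℝ F]
    {M : Type*} [TopologicalSpace M] [T2Space M] [SigmaCompactSpace M]
    [ChartedSpace B M] [IsManifold 𝓘(ℝ, B) ∞ M]
    {E : M → Type*} [∀ x, AddCommGroup (E x)] [∀ x, Module ℝ (E x)]
    [∀ x, TopologicalSpace (E x)] [TopologicalSpace (TotalSpace F E)]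
    [FiberBundle F E] [VectorBundle ℝ F E] [ContMDiffVectorBundle ∞ F E 𝓘(ℝ, B)]
    (A : GenLieAlg.GenLieAlgebroid B F M E) (g : GenLieAlg.LocInvMorphism A)
    (D : Set (TotalSpace F E)) (hD : D = univ ∨ D = {u : TotalSpace F E | u.2 ≠ 0})
    (𝔐 𝔐' : GenLieAlg.MechanicalSystem A D) (S S' : GenLieAlg.PSection A)
    (hS : GenLieAlg.IsSprayOf 𝔐 g S) (hS' : GenLieAlg.IsSprayOf 𝔐' g S') :
    GenLieAlg.ProjectivelyRelated D S S' ↔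
      GenLieAlg.GeodesicsReparamInto g S S' ∧ GenLieAlg.GeodesicsReparamInto g S' S := by
  have hDo : IsOpen D := by
    rcases hD with rfl | rfl
    · exact isOpen_univ
    · exact GenLieAlg.isOpen_ne_zero
  have hDs : {u : TotalSpace F E | u.2 ≠ 0} ⊆ D := by
    rcases hD with rfl | rfl
    · exact subset_univ _
    · exact Subset.rfl
  have : CompleteSpace B := FiniteDimensional.complete ℝ B
  have : CompleteSpace F := FiniteDimensional.complete ℝ F
  exact ⟨GenLieAlg.geodesicsReparamInto_of_projectivelyRelated hS hS' hDs,
    fun h => GenLieAlg.projectivelyRelated_of_geodesicsReparamInto hS hS' hDo h.1⟩
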